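/- All modules are over $\mathbb{C}$. For a partition $\mu\vdash b$ let $S^\mu$ be the Specht module of the symmetric group $S_b$ (the span of the polytabloids $e_t$, $t$ a $\mu$-tableau), and let $\mu^\perp$ be the conjugate partition. For $\nu\vdash b$ and $a\ge 0$ let $F_\nu^a=\big(\mathrm{Inf}_{S_b}^{S_a\wr S_b}S^\nu\big)\uparrow^{S_{ab}}$ be the generalized Foulkes module: $S^\nu$ is inflated along the projection $S_a\wr S_b\to S_b$ and then induced along $S_a\wr S_b\to S_{ab}$, where $S_a\wr S_b$ acts on the parts of a fixed ordered partition $X^0$ of $\{1,\dots,ab\}$ into $b$ sets of size $a$ (with $S_0\wr S_b=S_b$ for $a=0$). For an ordered set partition $X=gX^0$ ($g\in S_{ab}$) and a $\nu$-tableau $t$ put $e_{t_X}=g\,e_t\in F_\nu^a$, where $e_t\in S^\nu$ is regarded as an element of the induced module. For $a\ge 1$ let $U_{\nu,a}$, the $(1^b)$-summand of the restriction of $F_\nu^a$ to $S_b\times S_{ab-b}$ ($S_b$ acting on $\{1,\dots,b\}$ and $S_{ab-b}$ on $\{b+1,\dots,ab\}$), be the submodule generated by all $e_{t_X}$ such that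 every part of $X$ contains exactly one element of $\{1,\dots,b\}$. **Corollary.** For all integers $a\ge 1$ and $b\ge 0$ there is an isomorphism of $S_b\times S_{ab-b}$-modules $$U_{(1^b),a}\;\cong\;\bigoplus_{\lambda\vdash b} S^{\lambda^\perp}\otimes F_\lambda^{a-1},$$ and in particular, for $a=2$, an isomorphism of $S_b\times S_b$-modules $$U_{(1^b),2}\;\cong\;\bigoplus_{\lambda\vdash b} S^{\lambda^\perp}\otimes S^{\lambda},$$ where $\otimes$ is the external tensor product. -/

import Mathlib

open scoped TensorProduct DirectSum

noncomputable section

namespace GenFoulkes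

/-! ### Partitions as Young diagrams -/

/-- The partitions of `n`, as Young diagrams with `n` boxes. The box `(i, j)` lies in row `i` and
column `j` (counted from `0`), so the parts of the partition are the row lengths. -/
abbrev Ptn (n : ℕ) : Type := {μ : YoungDiagram // μ.card = n}

theorem card_transpose (μ : YoungDiagram) : μ.transpose.card = μ.card := by
  unfold YoungDiagram.card YoungDiagram.transpose
  simp

/-- The conjugate partition. -/
def Ptn.conj {n : ℕ} (μ : Ptn n) : Ptn n :=
  ⟨μ.1.transpose, (card_transpose μ.1).trans μ.2⟩

/-- The partition `(1^n)`: a single column of `n` boxes. -/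
def column (n : ℕ) : Ptn n :=
  ⟨{ cells := (Finset.range n).map ⟨fun i => (i, 0), fun i j h => (Prod.mk.inj h).1⟩
     isLowerSet := by
      rintro ⟨i, j⟩ ⟨i', j'⟩ ⟨h₁, h₂⟩ h
      simp only [Finset.coe_map, Set.mem_image, Finset.mem_coe, Finset.mem_range] at h ⊢
      obtain ⟨x, hx, hxy⟩ := h
      obtain ⟨rfl, rfl⟩ := Prod.mk.inj hxy
      exact ⟨i', lt_of_le_of_lt h₁ hx, Prod.ext rfl (Nat.le_zero.mp h₂).symm⟩ }, by
    simp [YoungDiagram.card]⟩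

/-! ### Specht modules -/

/-- A `μ`-tableau: a bijective filling of the boxes of `μ`, given by the map that sends each entry
to its box. -/
abbrev Tableau {n : ℕ} (μ : Ptn n) : Type := Fin n ≃ {c : ℕ × ℕ // c ∈ μ.1.cells}

/-- The row of the entry `x` in the tableau `t`. -/
def Tableau.row {n : ℕ} {μ : Ptn n} (t : Tableau μ) (x : Fin n) : ℕ := (t x).1.1

/-- The column of the entry `x` in the tableau `t`. -/
def Tableau.col {n : ℕ} {μ : Ptn n} (t : Tableau μ) (x : Fin n) : ℕ := (t x).1.2

/-- The symmetric group permutes the entries of a tableau: the entry `σ x` of `σ t` is in the box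
of the entry `x` of `t`. -/
def Tableau.act {n : ℕ} {μ : Ptn n} (σ : Equiv.Perm (Fin n)) (t : Tableau μ) : Tableau μ :=
  σ.symm.trans t

/-- Two tableaux are row equivalent if they have the same entries in each row. -/
def rowSetoid {n : ℕ} (μ : Ptn n) : Setoid (Tableau μ) where
  r t s := ∀ x, t.row x = s.row x
  iseqv := ⟨fun _ _ => rfl, fun h x => (h x).symm, fun h h' x => (h x).trans (h' x)⟩

/-- The `μ`-tabloids: row equivalence classes of `μ`-tableaux. -/
def Tabloid {n : ℕ} (μ : Ptn n) : Type := Quotient (rowSetoid μ)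

/-- The tabloid `{t}`. -/
def Tabloid.mk {n : ℕ} {μ : Ptn n} (t : Tableau μ) : Tabloid μ := Quotient.mk (rowSetoid μ) t

/-- The action `σ {t} = {σ t}` of the symmetric group on tabloids. -/
instance tabloidAction {n : ℕ} (μ : Ptn n) : MulAction (Equiv.Perm (Fin n)) (Tabloid μ) where
  smul σ := Quotient.map (Tableau.act σ) fun _ _ h x => h (σ.symm x)
  one_smul := by rintro ⟨t⟩; rfl
  mul_smul := by rintro σ τ ⟨t⟩; rfl

theorem smul_mk {n : ℕ} {μ : Ptn n} (σ : Equiv.Perm (Fin n)) (t : Tableau μ) :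
    σ • Tabloid.mk t = Tabloid.mk (t.act σ) := rfl

/-- The permutation module `M^μ` on the `μ`-tabloids, over `ℂ`. -/
abbrev tabloidModule {n : ℕ} (μ : Ptn n) :
    Representation ℂ (Equiv.Perm (Fin n)) (MonoidAlgebra ℂ (Tabloid μ)) :=
  Representation.ofMulAction ℂ (Equiv.Perm (Fin n)) (Tabloid μ)

/-- The column stabilizer `C_t`: the permutations that map each column of `t` to itself. -/
def colStab {n : ℕ} {μ : Ptn n} (t : Tableau μ) : Subgroup (Equiv.Perm (Fin n)) where
  carrier := {π | ∀ x, t.col (π x) = t.col x}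
  one_mem' _ := rfl
  mul_mem' {π ρ} hπ hρ x := (hπ (ρ x)).trans (hρ x)
  inv_mem' {π} hπ x := by
    have h := hπ (π⁻¹ x)
    rwa [← Equiv.Perm.mul_apply, mul_inv_cancel, Equiv.Perm.one_apply, eq_comm] at h

open scoped Classical in
/-- The polytabloid `e_t = ∑_{π ∈ C_t} sgn(π) {π t}`. -/
def polytabloid {n : ℕ} {μ : Ptn n} (t : Tableau μ) : MonoidAlgebra ℂ (Tabloid μ) :=
  ∑ π : colStab t, ((Equiv.Perm.sign π.1 : ℤ) : ℂ) •
    MonoidAlgebra.single (Tabloid.mk (t.act π.1)) (1 : ℂ)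

theorem mem_colStab_act {n : ℕ} {μ : Ptn n} (σ π : Equiv.Perm (Fin n)) (t : Tableau μ) :
    σ * π * σ⁻¹ ∈ colStab (t.act σ) ↔ π ∈ colStab t := by
  constructor
  · intro h x
    have := h (σ x)
    simpa [Tableau.col, Tableau.act] using this
  · intro h x
    have := h (σ⁻¹ x)
    simpa [Tableau.col, Tableau.act, Equiv.Perm.inv_def] using this

/-- `σ e_t = e_{σ t}`. -/
theorem tabloidModule_polytabloid {n : ℕ} {μ : Ptn n} (σ : Equiv.Perm (Fin n)) (t : Tableau μ) :
    tabloidModule μ σ (polytabloid t) = polytabloid (t.act σ) := by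
  classical
  unfold polytabloid
  rw [map_sum]
  refine Fintype.sum_equiv
    ((MulAut.conj σ).toEquiv.subtypeEquiv fun π => (mem_colStab_act σ π t).symm) _ _ ?_
  rintro ⟨π, hπ⟩
  have h : (t.act σ).act (σ * π * σ⁻¹) = (t.act π).act σ := by
    refine Equiv.ext fun x => ?_
    change t (σ.symm (σ (π.symm (σ.symm x)))) = t (π.symm (σ.symm x))
    rw [Equiv.symm_apply_apply]
  have h' : Equiv.Perm.sign (σ * π * σ⁻¹) = Equiv.Perm.sign π := by
    rw [map_mul, map_mul, map_inv, mul_comm, inv_mul_cancel_left]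
  simp only [map_smul, Representation.ofMulAction_single, smul_mk, Equiv.subtypeEquiv,
    Equiv.coe_fn_mk, MulEquiv.toEquiv_eq_coe, MulEquiv.coe_toEquiv, MulAut.conj_apply, h, h']

/-- The Specht module `S^μ` as a submodule of `M^μ`: the span of the polytabloids. -/
def spechtSub {n : ℕ} (μ : Ptn n) : Subrepresentation (tabloidModule μ) where
  toSubmodule := Submodule.span ℂ (Set.range fun t : Tableau μ => polytabloid t)
  apply_mem_toSubmodule σ v hv := by
    refine Submodule.span_induction ?_ (by simp) (fun _ _ _ _ h h' => ?_) (fun c _ _ h => ?_) hv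
    · rintro _ ⟨t, rfl⟩
      rw [tabloidModule_polytabloid]
      exact Submodule.subset_span ⟨_, rfl⟩
    · rw [map_add]; exact Submodule.add_mem _ h h'
    · rw [map_smul]; exact Submodule.smul_mem _ c h

/-- The Specht module `S^μ` as a representation of the symmetric group. -/
abbrev specht {n : ℕ} (μ : Ptn n) :
    Representation ℂ (Equiv.Perm (Fin n)) (spechtSub μ).toSubmodule :=
  (spechtSub μ).toRepresentation

/-- The polytabloid `e_t` as an element of `S^μ`. -/
def spechtPolytabloid {n : ℕ} {μ : Ptn n} (t : Tableau μ) : (spechtSub μ).toSubmodule :=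
  ⟨polytabloid t, Submodule.subset_span ⟨t, rfl⟩⟩

/-! ### Generalized Foulkes modules -/

/-- The reference ordered set partition `X⁰` of the `a * b` points into `b` sets of size `a`: the
point `x` lies in the block numbered `x mod b`. -/
abbrev block (a b : ℕ) (x : Fin (a * b)) : Fin b := x.modNat

/-- The wreath product `S_a ≀ S_b` with its action on the `a * b` points and on the `b` blocks:
all pairs `(g, σ)` such that `g` maps the `i`-th block to the `σ i`-th block, for each `i`. (If
`1 ≤ a`, then `g` determines `σ`, and these are the permutations that preserve the set of blocks;
keeping track of `σ` gives `S_0 ≀ S_b = S_b` for `a = 0`.) -/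
def wreath (a b : ℕ) : Subgroup (Equiv.Perm (Fin (a * b)) × Equiv.Perm (Fin b)) where
  carrier := {w | ∀ x, block a b (w.1 x) = w.2 (block a b x)}
  one_mem' _ := rfl
  mul_mem' {w w'} h h' x := by
    exact (h (w'.1 x)).trans (congrArg w.2 (h' x))
  inv_mem' {w} h x := by
    have := h (w.1⁻¹ x)
    rw [← Equiv.Perm.mul_apply, mul_inv_cancel, Equiv.Perm.one_apply] at this
    rw [Prod.snd_inv, Prod.fst_inv, this, ← Equiv.Perm.mul_apply, inv_mul_cancel,
      Equiv.Perm.one_apply]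

/-- The action homomorphism `S_a ≀ S_b → S_{ab}` (an embedding if `1 ≤ a`). -/
def wreathToPoints (a b : ℕ) : wreath a b →* Equiv.Perm (Fin (a * b)) :=
  (MonoidHom.fst _ _).comp (wreath a b).subtype

/-- The projection `S_a ≀ S_b → S_b`. -/
def wreathToBlocks (a b : ℕ) : wreath a b →* Equiv.Perm (Fin b) :=
  (MonoidHom.snd _ _).comp (wreath a b).subtype

/-- The inflation of `S^ν` along `S_a ≀ S_b → S_b`. -/
abbrev inflation (a : ℕ) {b : ℕ} (ν : Ptn b) :
    Representation ℂ (wreath a b) (spechtSub ν).toSubmodule :=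
  (specht ν).comp (wreathToBlocks a b)

/-- The generalized Foulkes module `F_ν^a`: the `S_{ab}`-module induced by the inflation of `S^ν`
to `S_a ≀ S_b`. -/
abbrev foulkes (a : ℕ) {b : ℕ} (ν : Ptn b) :
    Representation ℂ (Equiv.Perm (Fin (a * b)))
      (Representation.IndV (wreathToPoints a b) (inflation a ν)) :=
  Representation.ind (wreathToPoints a b) (inflation a ν)

/-- The element `e_{t_X}` of `F_ν^a` for the ordered set partition `X = g X⁰`. With the polytabloid
`e_t` of `S^ν` viewed in the induced module (`e_{t_X}` for `X = X⁰`), it is `g e_t`. Each ordered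
set partition into `b` sets of size `a` is of the form `g X⁰`. -/
def foulkesPolytabloid (a : ℕ) {b : ℕ} {ν : Ptn b} (g : Equiv.Perm (Fin (a * b)))
    (t : Tableau ν) : Representation.IndV (wreathToPoints a b) (inflation a ν) :=
  foulkes a ν g (Representation.IndV.mk (wreathToPoints a b) (inflation a ν) 1
    (spechtPolytabloid t))

/-! ### The components of the restriction to `S_k × S_{n-k}` -/

/-- The embedding of `S_k × S_l` in `S_n`, `n = k + l`: the first factor permutes the first `k`
points and the second one the last `l` points. -/
def young {k l n : ℕ} (h : k + l = n) :
    Equiv.Perm (Fin k) × Equiv.Perm (Fin l) →* Equiv.Perm (Fin n) :=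
  (Equiv.permCongrHom (finSumFinEquiv.trans (finCongr h))).toMonoidHom.comp
    (Equiv.Perm.sumCongrHom (Fin k) (Fin l))

/-- The restriction of `F_ν^a` to `S_k × S_l`, where `k + l = ab`. -/
abbrev foulkesRes {k l : ℕ} (a : ℕ) {b : ℕ} (ν : Ptn b) (h : k + l = a * b) :
    Representation ℂ (Equiv.Perm (Fin k) × Equiv.Perm (Fin l))
      (Representation.IndV (wreathToPoints a b) (inflation a ν)) :=
  (foulkes a ν).comp (young h)

/-- The number of elements that the `i`-th part of the ordered set partition `X = g X⁰` has among
the first `k` points. -/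
def interCard (k a b : ℕ) (g : Equiv.Perm (Fin (a * b))) (i : Fin b) : ℕ :=
  (Finset.univ.filter fun x : Fin (a * b) => block a b x = i ∧ (g x : ℕ) < k).card

/-- `X = g X⁰` belongs to `P_lam`: the nonzero sizes of the intersections of the parts of `X` with
the set of the first `k` points are the parts of the partition `lam` of `k`. -/
def InP {k : ℕ} (lam : Ptn k) (a b : ℕ) (g : Equiv.Perm (Fin (a * b))) : Prop :=
  ((Finset.univ : Finset (Fin b)).val.map (interCard k a b g)).filter (fun m => m ≠ 0) =
    (lam.1.rowLens : Multiset ℕ)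

theorem young_lt_iff {k l n : ℕ} (h : k + l = n) (y : Equiv.Perm (Fin k) × Equiv.Perm (Fin l))
    (x : Fin n) : (young h y x : ℕ) < k ↔ (x : ℕ) < k := by
  subst h
  refine Fin.addCases (fun i => ?_) (fun i => ?_) x <;> simp [young]

theorem inP_young_mul {k l a b : ℕ} (h : k + l = a * b) (lam : Ptn k)
    (y : Equiv.Perm (Fin k) × Equiv.Perm (Fin l)) (g : Equiv.Perm (Fin (a * b))) :
    InP lam a b (young h y * g) ↔ InP lam a b g := by
  have : interCard k a b (young h y * g) = interCard k a b g := by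
    funext i
    simp [interCard, young_lt_iff]
  rw [InP, InP, this]

/-- The `lam`-component `V_{ν,a}^lam` of the restriction of `F_ν^a` to `S_k × S_l`: the submodule
generated by the elements `e_{t_X}` with `X ∈ P_lam` and `t` a `ν`-tableau. (The group permutes
these elements, so it is their linear span.) -/
def component {k l : ℕ} (a : ℕ) {b : ℕ} (ν : Ptn b) (h : k + l = a * b) (lam : Ptn k) :
    Subrepresentation (foulkesRes a ν h) where
  toSubmodule := Submodule.span ℂ
    {v | ∃ (g : Equiv.Perm (Fin (a * b))) (t : Tableau ν),
      InP lam a b g ∧ v = foulkesPolytabloid a g t}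
  apply_mem_toSubmodule y v hv := by
    refine Submodule.span_induction ?_ (by simp) (fun _ _ _ _ h h' => ?_) (fun c _ _ h => ?_) hv
    · rintro _ ⟨g, t, hg, rfl⟩
      refine Submodule.subset_span ⟨young h y * g, t, (inP_young_mul h lam y g).2 hg, ?_⟩
      rw [foulkesPolytabloid, foulkesPolytabloid, map_mul]
      rfl
    · rw [map_add]; exact Submodule.add_mem _ h h'
    · rw [map_smul]; exact Submodule.smul_mem _ c h

/-- `U_{ν,a} = V_{ν,a}^{(1^b)}`, the `(1^b)`-component of the restriction of `F_ν^a` to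
`S_b × S_l`, where `b + l = ab`. -/
abbrev U {l : ℕ} (a : ℕ) {b : ℕ} (ν : Ptn b) (h : b + l = a * b) :
    Representation ℂ (Equiv.Perm (Fin b) × Equiv.Perm (Fin l))
      (component a ν h (column b)).toSubmodule :=
  (component a ν h (column b)).toRepresentation

/-- The external tensor product of a `G`-module and an `H`-module, a `G × H`-module. -/
abbrev extTensor {G H V W : Type*} [Group G] [Group H] [AddCommGroup V] [Module ℂ V]
    [AddCommGroup W] [Module ℂ W] (ρ : Representation ℂ G V) (τ : Representation ℂ H W) :
    Representation ℂ (G × H) (V ⊗[ℂ] W) :=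
  Representation.tprod (ρ.comp (MonoidHom.fst G H)) (τ.comp (MonoidHom.snd G H))

theorem add_pred_mul {a : ℕ} (b : ℕ) (ha : 1 ≤ a) : b + (a - 1) * b = a * b := by
  obtain ⟨c, rfl⟩ := Nat.exists_eq_add_of_le ha
  rw [Nat.add_sub_cancel_left]
  ring

end GenFoulkes

end

open GenFoulkes

/-!
Both sides are induced from the same linear character of the same subgroup of `S_b × S_l`, where
`l = ab - b`.

On the left, `S_b × S_l` permutes transitively the ordered set partitions of which every part
contains exactly one of the first `b` points, so that `U` is spanned by the orbit of `e_{t_{X⁰}}`.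
An element of `S_b × S_l` that permutes the parts of `X⁰` permutes them as its component in `S_b`
does. Hence the stabilizer of `X⁰` up to the order of its parts is a copy of `S_{a-1} ≀ S_b`, and it
acts on `e_{t_{X⁰}}` by the sign of that component, because `S^{(1^b)}` is the sign character.

On the right, for `a = 2`, the matrix coefficients identify `⨁ S^λ ⊗ S^λ` with the functions on
`S_b`, which are induced from the trivial character of the diagonal by the delta function at `1`.
The matrix coefficients are independent by James' submodule theorem and the dominance order; the
delta function is reached through class functions, since there are at least as many partitions as
conjugacy classes. Tensoring with the sign replaces `S^λ` by `S^{λ'}` in the first factor, and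
inducing the second factor along the wreath product gives the case of general `a`.
-/

noncomputable section

namespace GenFoulkes

/-! ### Modules induced from a linear character -/

section MonomialGenerator

variable {k K V V' : Type*} [Field k] [Group K] [AddCommMonoid V] [Module k V]
  [AddCommMonoid V'] [Module k V']

/-- `e` generates `V` as a module induced from the linear character `χ` of the subgroup `J`: it
spans a copy of `χ` over `J`, and its translates by representatives of the cosets of `J` are a basis
of `V`. Their linear independence is encoded by a functional that separates `e` from its translates
outside `J`. Only the values of `χ` on `J` matter. -/
structure IsMonomialGenerator (J : Subgroup K) (χ : K →* k) (ρ : Representation k K V) (e : V) :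
    Prop where
  span_orbit : Submodule.span k (Set.range fun x => ρ x e) = ⊤
  apply_of_mem : ∀ u ∈ J, ρ u e = χ u • e
  exists_dual : ∃ c : V →ₗ[k] k, c e ≠ 0 ∧ ∀ x ∉ J, c (ρ x e) = 0

/-- The twist of a representation by a linear character. -/
def twist (χ : K →* k) (ρ : Representation k K V) : Representation k K V where
  toFun x := χ x • ρ x
  map_one' := by rw [map_one, map_one, one_smul]
  map_mul' x y := by rw [map_mul, map_mul, smul_mul_smul_comm]

theorem twist_apply (χ : K →* k) (ρ : Representation k K V) (x : K) (v : V) :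
    twist χ ρ x v = χ x • ρ x v := rfl

instance isIrreducible_twist {V : Type*} [AddCommGroup V] [Module k V] (χ : K →* k)
    (ρ : Representation k K V) [ρ.IsIrreducible] : (twist χ ρ).IsIrreducible :=
  let e : Subrepresentation (twist χ ρ) ≃o Subrepresentation ρ :=
    { toFun := fun N => ⟨N.toSubmodule, fun x _ hv =>
        (N.toSubmodule.smul_mem_iff ((Group.isUnit x).map χ).ne_zero).1
          (N.apply_mem_toSubmodule x hv)⟩
      invFun := fun N => ⟨N.toSubmodule, fun x _ hv =>
        N.toSubmodule.smul_mem _ (N.apply_mem_toSubmodule x hv)⟩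
      map_rel_iff' := Iff.rfl }
  e.isSimpleOrder

theorem exists_eq_out_mul (J : Subgroup K) (x : K) :
    ∃ u ∈ J, x = (x : K ⧸ J).out * u := by
  obtain ⟨u, hu⟩ := QuotientGroup.mk_out_eq_mul J x
  exact ⟨(u : K)⁻¹, J.inv_mem u.2, by rw [hu, mul_inv_cancel_right]⟩

namespace IsMonomialGenerator

variable {J : Subgroup K} {χ : K →* k} {ρ : Representation k K V} {e : V}
  {ρ' : Representation k K V'} {e' : V'}

theorem apply_mul_of_mem (he : IsMonomialGenerator J χ ρ e) (x : K) {u : K} (hu : u ∈ J) :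
    ρ (x * u) e = χ u • ρ x e := by
  rw [map_mul, Module.End.mul_apply, he.apply_of_mem u hu, map_smul]

theorem linearIndependent_coset (he : IsMonomialGenerator J χ ρ e) :
    LinearIndependent k fun q : K ⧸ J => ρ q.out e := by
  obtain ⟨c, hc, hcJ⟩ := he.exists_dual
  have coord (a : K ⧸ J →₀ k) (q : K ⧸ J) :
      c (ρ q.out⁻¹ (Finsupp.linearCombination k (fun q : K ⧸ J => ρ q.out e) a)) = a q * c e := by
    rw [Finsupp.linearCombination_apply, Finsupp.sum, map_sum, map_sum, Finset.sum_eq_single q]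
    · rw [map_smul, map_smul, Representation.inv_self_apply, smul_eq_mul]
    · intro q' _ hq'
      rw [map_smul, map_smul, ← Module.End.mul_apply, ← map_mul, hcJ, smul_zero]
      rw [← QuotientGroup.eq, QuotientGroup.out_eq', QuotientGroup.out_eq']
      exact hq'.symm
    · intro hq
      rw [Finsupp.notMem_support_iff.1 hq, zero_smul, map_zero, map_zero]
  intro a a' h
  refine Finsupp.ext fun q => mul_right_cancel₀ hc ?_
  rw [← coord, ← coord, h]

theorem span_coset (he : IsMonomialGenerator J χ ρ e) :
    ⊤ ≤ Submodule.span k (Set.range fun q : K ⧸ J => ρ q.out e) := by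
  rw [← he.span_orbit, Submodule.span_le]
  rintro _ ⟨x, rfl⟩
  obtain ⟨u, hu, hx⟩ := exists_eq_out_mul J x
  change ρ x e ∈ _
  rw [hx, he.apply_mul_of_mem _ hu]
  exact Submodule.smul_mem _ _ (Submodule.subset_span ⟨_, rfl⟩)

theorem nonempty_equiv (he : IsMonomialGenerator J χ ρ e) (he' : IsMonomialGenerator J χ ρ' e') :
    Nonempty (ρ.Equiv ρ') := by
  let B := Module.Basis.mk he.linearIndependent_coset he.span_coset
  let B' := Module.Basis.mk he'.linearIndependent_coset he'.span_coset
  let L := B.equiv B' (Equiv.refl _)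
  have hL (x : K) : L (ρ x e) = ρ' x e' := by
    obtain ⟨u, hu, hx⟩ := exists_eq_out_mul J x
    have hB : L (B x) = B' x := B.equiv_apply _ _ _
    rw [hx, he.apply_mul_of_mem _ hu, he'.apply_mul_of_mem _ hu, map_smul]
    simpa only [B, B', Module.Basis.mk_apply] using congrArg (χ u • ·) hB
  refine ⟨.mk L fun x => LinearMap.ext_on he.span_orbit ?_⟩
  rintro _ ⟨y, rfl⟩
  change L (ρ x (ρ y e)) = ρ' x (L (ρ y e))
  rw [hL, ← Module.End.mul_apply, ← Module.End.mul_apply, ← map_mul, ← map_mul, hL]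

theorem map (he : IsMonomialGenerator J χ ρ e) (f : ρ.Equiv ρ') :
    IsMonomialGenerator J χ ρ' (f e) := by
  have hf (x : K) : f (ρ x e) = ρ' x (f e) :=
    Representation.IntertwiningMap.isIntertwining ρ ρ' f.toIntertwiningMap x e
  obtain ⟨c, hc, hcJ⟩ := he.exists_dual
  refine ⟨?_, fun u hu => ?_, c ∘ₗ f.symm.toLinearMap, ?_, fun x hx => ?_⟩
  · simp only [← hf]
    rw [Set.range_comp' f]
    exact (Submodule.map_span f.toLinearMap _).symm.trans
      (by rw [he.span_orbit, Submodule.map_top]; exact f.toLinearEquiv.range)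
  · rw [← hf, he.apply_of_mem u hu, map_smul]
  · exact (congrArg c (f.symm_apply_apply e)).trans_ne hc
  · rw [← hf]
    exact (congrArg c (f.symm_apply_apply _)).trans (hcJ x hx)

theorem twist (he : IsMonomialGenerator J χ ρ e) (ψ : K →* k) :
    IsMonomialGenerator J (ψ * χ) (twist ψ ρ) e where
  span_orbit := by
    refine top_le_iff.1 (he.span_orbit.ge.trans (Submodule.span_le.2 ?_))
    rintro _ ⟨x, rfl⟩
    have hψ : ψ x ≠ 0 := ((Group.isUnit x).map ψ).ne_zero
    exact (Submodule.smul_mem_iff _ hψ).1 (Submodule.subset_span ⟨x, rfl⟩)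
  apply_of_mem u hu := by
    rw [twist_apply, he.apply_of_mem u hu, smul_smul, MonoidHom.mul_apply]
  exists_dual := by
    obtain ⟨c, hc, hcJ⟩ := he.exists_dual
    exact ⟨c, hc, fun x hx => by rw [twist_apply, map_smul, hcJ x hx, smul_zero]⟩

end IsMonomialGenerator

end MonomialGenerator

/-! ### Induction along a homomorphism -/

section Induced

variable {k G H A : Type*} [CommRing k] [Group G] [Group H] (φ : G →* H)
  [AddCommGroup A] [Module k A] (ρ : Representation k G A)

theorem ind_mk_one (h : H) (a : A) :
    Representation.ind φ ρ h (Representation.IndV.mk φ ρ 1 a) =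
      Representation.IndV.mk φ ρ h⁻¹ a := by
  rw [Representation.ind_mk φ ρ h 1 a, one_mul]

theorem ind_map_mk_one (w : G) (a : A) :
    Representation.ind φ ρ (φ w) (Representation.IndV.mk φ ρ 1 a) =
      Representation.IndV.mk φ ρ 1 (ρ w a) := by
  rw [ind_mk_one]
  simpa using (Representation.Coinvariants.mk_self_apply
    (Representation.tprod ((Representation.leftRegular k H).comp φ) ρ) w
    (MonoidAlgebra.single (φ w)⁻¹ 1 ⊗ₜ a)).symm

variable [Fintype G]

open scoped Classical in
/-- The component at the identity coset of an element of an induced module, scaled by the order of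
the kernel of `φ`: it maps `h` times the image of `a` to the sum of the `ρ w a` with `φ w = h`. -/
def indCoeff : Representation.IndV φ ρ →ₗ[k] A :=
  Representation.Coinvariants.lift _ (TensorProduct.lift <| (Finsupp.lift _ _ _ fun h =>
      ∑ w with φ w * h = 1, ρ w) ∘ₗ (MonoidAlgebra.coeffLinearEquiv k).toLinearMap) fun w₀ => by
    have shift (h : H) (a : A) :
        ∑ w with φ w * (φ w₀ * h) = 1, ρ w (ρ w₀ a) = ∑ w with φ w * h = 1, ρ w a := by
      refine Finset.sum_equiv (Equiv.mulRight w₀) (fun w => ?_) fun w _ => ?_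
      · simp [mul_assoc]
      · rw [Equiv.coe_mulRight, map_mul, Module.End.mul_apply]
    ext h a
    simpa using shift h a

theorem indCoeff_ind_mk_one [DecidableEq H] (h : H) (a : A) :
    indCoeff φ ρ (Representation.ind φ ρ h (Representation.IndV.mk φ ρ 1 a)) =
      ∑ w with φ w = h, ρ w a := by
  rw [ind_mk_one]
  simp [indCoeff, mul_inv_eq_one]

end Induced

/-! ### Sums of external tensor products -/

section BoxSum

variable {ι G H : Type*} [Group G] [Group H] {X X' X'' Y Y' Y'' : ι → Type*}
  [∀ i, AddCommGroup (X i)] [∀ i, Module ℂ (X i)] [∀ i, AddCommGroup (X' i)]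
  [∀ i, Module ℂ (X' i)] [∀ i, AddCommGroup (X'' i)] [∀ i, Module ℂ (X'' i)]
  [∀ i, AddCommGroup (Y i)] [∀ i, Module ℂ (Y i)] [∀ i, AddCommGroup (Y' i)]
  [∀ i, Module ℂ (Y' i)] [∀ i, AddCommGroup (Y'' i)] [∀ i, Module ℂ (Y'' i)]

/-- The direct sum of the external tensor products of two families of representations. -/
abbrev boxSum (ξ : ∀ i, Representation ℂ G (X i)) (η : ∀ i, Representation ℂ H (Y i)) :
    Representation ℂ (G × H) (⨁ i, X i ⊗[ℂ] Y i) :=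
  Representation.directSum fun i => extTensor (ξ i) (η i)

/-- The map between direct sums of tensor products given by linear maps of the factors. -/
def boxSumMap (f : ∀ i, X i →ₗ[ℂ] X' i) (g : ∀ i, Y i →ₗ[ℂ] Y' i) :
    (⨁ i, X i ⊗[ℂ] Y i) →ₗ[ℂ] ⨁ i, X' i ⊗[ℂ] Y' i :=
  DirectSum.lmap fun i => TensorProduct.map (f i) (g i)

theorem boxSum_apply (ξ : ∀ i, Representation ℂ G (X i)) (η : ∀ i, Representation ℂ H (Y i))
    (x : G × H) : boxSum ξ η x = boxSumMap (fun i => ξ i x.1) fun i => η i x.2 := rfl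

theorem boxSumMap_lof [DecidableEq ι] (f : ∀ i, X i →ₗ[ℂ] X' i) (g : ∀ i, Y i →ₗ[ℂ] Y' i) (i : ι)
    (z : X i ⊗[ℂ] Y i) :
    boxSumMap f g (DirectSum.lof ℂ ι (fun i => X i ⊗[ℂ] Y i) i z) =
      DirectSum.lof ℂ ι (fun i => X' i ⊗[ℂ] Y' i) i (TensorProduct.map (f i) (g i) z) :=
  DirectSum.lmap_lof _ _ _

theorem boxSum_hom_ext [DecidableEq ι] {M : Type*} [AddCommMonoid M] [Module ℂ M]
    {F F' : (⨁ i, X i ⊗[ℂ] Y i) →ₗ[ℂ] M}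
    (h : ∀ i u v, F (DirectSum.lof ℂ ι (fun i => X i ⊗[ℂ] Y i) i (u ⊗ₜ v)) =
      F' (DirectSum.lof ℂ ι (fun i => X i ⊗[ℂ] Y i) i (u ⊗ₜ v))) : F = F' :=
  DirectSum.linearMap_ext ℂ fun i => TensorProduct.ext' (h i)

theorem boxSumMap_boxSumMap (f' : ∀ i, X' i →ₗ[ℂ] X'' i) (g' : ∀ i, Y' i →ₗ[ℂ] Y'' i)
    (f : ∀ i, X i →ₗ[ℂ] X' i) (g : ∀ i, Y i →ₗ[ℂ] Y' i) (z : ⨁ i, X i ⊗[ℂ] Y i) :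
    boxSumMap f' g' (boxSumMap f g z) =
      boxSumMap (fun i => f' i ∘ₗ f i) (fun i => g' i ∘ₗ g i) z := by
  simp only [boxSumMap, TensorProduct.map_comp, DirectSum.lmap_comp, LinearMap.comp_apply]

theorem boxSumMap_sum {α : Type*} (s : Finset α) (f : ∀ i, X i →ₗ[ℂ] X' i)
    (g : α → ∀ i, Y i →ₗ[ℂ] Y' i) (z : ⨁ i, X i ⊗[ℂ] Y i) :
    boxSumMap f (fun i => ∑ w ∈ s, g w i) z = ∑ w ∈ s, boxSumMap f (g w) z := by
  classical
  rw [← LinearMap.sum_apply]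
  refine LinearMap.congr_fun (boxSum_hom_ext fun i u v => ?_) z
  simp only [LinearMap.sum_apply, boxSumMap_lof, TensorProduct.map_tmul, TensorProduct.tmul_sum,
    map_sum]

/-- The equivalence of direct sums of external tensor products given by equivalences of the left
factors. -/
def boxSumCongrLeft {ξ : ∀ i, Representation ℂ G (X i)} {ξ' : ∀ i, Representation ℂ G (X' i)}
    (f : ∀ i, (ξ i).Equiv (ξ' i)) (η : ∀ i, Representation ℂ H (Y i)) :
    (boxSum ξ η).Equiv (boxSum ξ' η) :=
  .mk (DFinsupp.mapRange.linearEquiv fun i => (f i).toLinearEquiv.rTensor (Y i)) fun x => by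
    classical
    refine boxSum_hom_ext fun i u v => ?_
    change boxSumMap _ (fun _ => LinearMap.id) (boxSumMap _ _ _) =
      boxSumMap _ _ (boxSumMap _ (fun _ => LinearMap.id) _)
    simp only [boxSumMap_lof, TensorProduct.map_tmul]
    congr 2
    exact Representation.IntertwiningMap.isIntertwining _ _ (f i).toIntertwiningMap x.1 u

theorem boxSum_twist (χ : G →* ℂ) (ξ : ∀ i, Representation ℂ G (X i))
    (η : ∀ i, Representation ℂ H (Y i)) :
    boxSum (fun i => twist χ (ξ i)) η = twist (χ.comp (MonoidHom.fst G H)) (boxSum ξ η) := by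
  classical
  refine MonoidHom.ext fun x => boxSum_hom_ext fun i u v => ?_
  rw [twist_apply, boxSum_apply, boxSum_apply, boxSumMap_lof, boxSumMap_lof, ← map_smul]
  rfl

end BoxSum

section InducedBoxSum

theorem iSup_range_indMk {k G H A : Type*} [CommRing k] [Group G] [Group H] (φ : G →* H)
    [AddCommGroup A] [Module k A] (ρ : Representation k G A) :
    ⨆ h, LinearMap.range (Representation.IndV.mk φ ρ h) = ⊤ := by
  rw [← Submodule.ker_mkQ (⨆ h, LinearMap.range (Representation.IndV.mk φ ρ h)),
    LinearMap.ker_eq_top]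
  refine Representation.IndV.hom_ext φ ρ fun h => LinearMap.ext fun a => ?_
  exact (Submodule.Quotient.mk_eq_zero _).2 (Submodule.mem_iSup_of_mem h ⟨a, rfl⟩)

variable {ι G H K : Type*} [Group G] [Group H] [Group K] {X Y : ι → Type*}
  [∀ i, AddCommGroup (X i)] [∀ i, Module ℂ (X i)] [∀ i, AddCommGroup (Y i)]
  [∀ i, Module ℂ (Y i)] (ψ : H →* G) (φ : H →* K)
  (ξ : ∀ i, Representation ℂ G (X i)) (η : ∀ i, Representation ℂ G (Y i))

/-- The representation `⨁ Xᵢ ⊗ Ind Yᵢ`, where `Yᵢ` is inflated along `ψ` and induced along `φ`. -/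
abbrev indBoxSum : Representation ℂ (G × K)
    (⨁ i, X i ⊗[ℂ] Representation.IndV φ ((η i).comp ψ)) :=
  boxSum ξ fun i => Representation.ind φ ((η i).comp ψ)

/-- The map `⨁ Xᵢ ⊗ Yᵢ → ⨁ Xᵢ ⊗ Ind Yᵢ` given by the maps of the `Yᵢ` to their induced modules that
send `y` to the class of `h ⊗ y`. -/
def toIndBoxSum (h : K) :
    (⨁ i, X i ⊗[ℂ] Y i) →ₗ[ℂ] ⨁ i, X i ⊗[ℂ] Representation.IndV φ ((η i).comp ψ) :=
  boxSumMap (fun _ => LinearMap.id) fun i => Representation.IndV.mk φ ((η i).comp ψ) h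

theorem indBoxSum_toIndBoxSum (g : G) (h : K) (z : ⨁ i, X i ⊗[ℂ] Y i) :
    indBoxSum ψ φ ξ η (g, h⁻¹) (toIndBoxSum ψ φ η 1 z) =
      toIndBoxSum ψ φ η h (boxSum ξ η (g, 1) z) := by
  simp only [boxSum_apply, toIndBoxSum, boxSumMap_boxSumMap]
  congr 2
  refine funext fun i => LinearMap.ext fun y => ?_
  rw [map_one]
  exact (ind_mk_one φ ((η i).comp ψ) h⁻¹ y).trans (by rw [inv_inv]; rfl)

theorem indBoxSum_toIndBoxSum_one (w : H) (z : ⨁ i, X i ⊗[ℂ] Y i) :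
    indBoxSum ψ φ ξ η (ψ w, φ w) (toIndBoxSum ψ φ η 1 z) =
      toIndBoxSum ψ φ η 1 (boxSum ξ η (ψ w, ψ w) z) := by
  simp only [boxSum_apply, toIndBoxSum, boxSumMap_boxSumMap]
  congr 2
  exact funext fun i => LinearMap.ext (ind_map_mk_one φ ((η i).comp ψ) w)

theorem eq_top_of_range_toIndBoxSum_le
    {N : Submodule ℂ (⨁ i, X i ⊗[ℂ] Representation.IndV φ ((η i).comp ψ))}
    (hN : ∀ h, LinearMap.range (toIndBoxSum ψ φ η h) ≤ N) : N = ⊤ := by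
  classical
  let L (i : ι) := DirectSum.lof ℂ ι (fun i => X i ⊗[ℂ] Representation.IndV φ ((η i).comp ψ)) i
  have hL (i : ι) (u : X i) (v) : L i (u ⊗ₜ v) ∈ N := by
    suffices hle : ⨆ h, LinearMap.range (Representation.IndV.mk φ ((η i).comp ψ) h) ≤
        N.comap (L i ∘ₗ TensorProduct.mk ℂ _ _ u) from
      hle (iSup_range_indMk φ ((η i).comp ψ) ▸ Submodule.mem_top)
    refine iSup_le fun h => ?_
    rintro _ ⟨y, rfl⟩
    exact hN h ⟨DirectSum.lof ℂ ι (fun i => X i ⊗[ℂ] Y i) i (u ⊗ₜ y), boxSumMap_lof _ _ _ _⟩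
  refine Submodule.eq_top_iff'.2 fun z => ?_
  induction z using DirectSum.induction_on with
  | zero => exact N.zero_mem
  | of i z =>
    induction z with
    | zero => exact (L i).map_zero.symm ▸ N.zero_mem
    | tmul u v => exact hL i u v
    | add z z' hz hz' => exact ((L i).map_add z z').symm ▸ N.add_mem hz hz'
  | add z z' hz hz' => exact N.add_mem hz hz'

section Dual

variable [Fintype H]

/-- The map `⨁ Xᵢ ⊗ Ind Yᵢ → ⨁ Xᵢ ⊗ Yᵢ` given by the components at the identity coset. -/
def boxSumIndCoeff :
    (⨁ i, X i ⊗[ℂ] Representation.IndV φ ((η i).comp ψ)) →ₗ[ℂ] ⨁ i, X i ⊗[ℂ] Y i :=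
  boxSumMap (fun _ => LinearMap.id) fun i => indCoeff φ ((η i).comp ψ)

open scoped Classical in
theorem boxSumIndCoeff_indBoxSum (x : G × K) (z : ⨁ i, X i ⊗[ℂ] Y i) :
    boxSumIndCoeff ψ φ η (indBoxSum ψ φ ξ η x (toIndBoxSum ψ φ η 1 z)) =
      ∑ w with φ w = x.2, boxSum ξ η (x.1, ψ w) z := by
  simp only [boxSum_apply, boxSumIndCoeff, toIndBoxSum, boxSumMap_boxSumMap]
  rw [← boxSumMap_sum]
  congr 2
  refine funext fun i => LinearMap.ext fun y => ?_
  exact (indCoeff_ind_mk_one φ ((η i).comp ψ) x.2 y).trans (LinearMap.sum_apply _ _ y).symm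

open scoped Classical in
theorem dual_boxSumIndCoeff_toIndBoxSum {q : ⨁ i, X i ⊗[ℂ] Y i} {d : (⨁ i, X i ⊗[ℂ] Y i) →ₗ[ℂ] ℂ}
    (hd : ∀ g g', g' ≠ g → d (boxSum ξ η (g, g') q) = 0) :
    d (boxSumIndCoeff ψ φ η (toIndBoxSum ψ φ η 1 q)) =
      (Finset.univ.filter fun w => φ w = 1 ∧ ψ w = 1).card * d q := by
  have hsum := congrArg d (boxSumIndCoeff_indBoxSum ψ φ ξ η 1 q)
  rw [map_one, Module.End.one_apply, map_sum] at hsum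
  rw [hsum, ← nsmul_eq_mul, ← Finset.sum_const, ← Finset.filter_filter, Finset.sum_filter (ψ · = 1)]
  refine Finset.sum_congr rfl fun w _ => ?_
  split_ifs with hw
  · exact congrArg d (by rw [hw]; exact LinearMap.congr_fun (map_one (boxSum ξ η)) q)
  · exact hd _ _ hw

end Dual

theorem IsMonomialGenerator.toIndBoxSum [Finite H] {χ : G →* ℂ} {q : ⨁ i, X i ⊗[ℂ] Y i}
    (hq : IsMonomialGenerator ((MonoidHom.id G).prod (MonoidHom.id G)).range
      (χ.comp (MonoidHom.fst G G)) (boxSum ξ η) q) :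
    IsMonomialGenerator (ψ.prod φ).range (χ.comp (MonoidHom.fst G K)) (indBoxSum ψ φ ξ η)
      (toIndBoxSum ψ φ η 1 q) where
  span_orbit := by
    refine eq_top_of_range_toIndBoxSum_le ψ φ η fun h => ?_
    rw [LinearMap.range_eq_map, ← hq.span_orbit, Submodule.map_span_le]
    rintro _ ⟨⟨g, g'⟩, rfl⟩
    have hdiag : ((g, g') : G × G) = (g * g'⁻¹, 1) * (g', g') := by simp
    have hmem : (g', g') ∈ ((MonoidHom.id G).prod (MonoidHom.id G)).range := ⟨g', rfl⟩
    change GenFoulkes.toIndBoxSum ψ φ η h (boxSum ξ η (g, g') q) ∈ _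
    rw [hdiag, hq.apply_mul_of_mem _ hmem, map_smul, ← indBoxSum_toIndBoxSum]
    exact Submodule.smul_mem _ _ (Submodule.subset_span ⟨_, rfl⟩)
  apply_of_mem := by
    rintro _ ⟨w, rfl⟩
    have hmem : (ψ w, ψ w) ∈ ((MonoidHom.id G).prod (MonoidHom.id G)).range := ⟨ψ w, rfl⟩
    change indBoxSum ψ φ ξ η (ψ w, φ w) _ = χ (ψ w) • _
    rw [indBoxSum_toIndBoxSum_one, hq.apply_of_mem _ hmem, map_smul]
    rfl
  exists_dual := by
    classical
    let _ : Fintype H := Fintype.ofFinite H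
    obtain ⟨d, hd, hdJ⟩ := hq.exists_dual
    have hoff (g g' : G) (h : g' ≠ g) : d (boxSum ξ η (g, g') q) = 0 := hdJ _ <| by
      rintro ⟨x, hx⟩
      exact h ((congrArg Prod.snd hx).symm.trans (congrArg Prod.fst hx))
    refine ⟨d ∘ₗ boxSumIndCoeff ψ φ η, ?_, fun x hx => ?_⟩
    · rw [LinearMap.comp_apply, dual_boxSumIndCoeff_toIndBoxSum ψ φ ξ η hoff]
      refine mul_ne_zero (Nat.cast_ne_zero.2 (Finset.card_pos.2 ⟨1, ?_⟩).ne') hd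
      simp only [Finset.mem_filter, Finset.mem_univ, map_one, and_self]
    · rw [LinearMap.comp_apply, boxSumIndCoeff_indBoxSum, map_sum]
      refine Finset.sum_eq_zero fun w hw => hoff _ _ fun h => hx ⟨w, ?_⟩
      exact Prod.ext h (Finset.mem_filter.1 hw).2

end InducedBoxSum

section Specht

variable {n : ℕ}

instance (μ : Ptn n) : Finite (Tabloid μ) := Quotient.finite _

instance (μ : Ptn n) : Fintype (Tabloid μ) := Fintype.ofFinite _

theorem card_cells (μ : Ptn n) : Fintype.card {c : ℕ × ℕ // c ∈ μ.1.cells} = n := by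
  rw [Fintype.card_coe]
  exact μ.2

instance (μ : Ptn n) : Nonempty (Tableau μ) :=
  ⟨Fintype.equivOfCardEq (by rw [card_cells, Fintype.card_fin])⟩

instance (μ : Ptn n) : Fintype (Tableau μ) := Fintype.ofFinite _

theorem tableau_ext {μ : Ptn n} (t : Tableau μ) {x y : Fin n} (hr : t.row x = t.row y)
    (hc : t.col x = t.col y) : x = y :=
  t.injective (Subtype.ext (Prod.ext hr hc))

theorem exists_act_eq {μ : Ptn n} (t s : Tableau μ) : ∃ σ : Equiv.Perm (Fin n), t.act σ = s :=
  ⟨t.trans s.symm, Equiv.ext fun x => by simp [Tableau.act]⟩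

theorem Tabloid.ind {μ : Ptn n} {p : Tabloid μ → Prop} (h : ∀ t, p (Tabloid.mk t)) (T) : p T :=
  Quotient.ind h T

theorem tabloid_hom_ext {μ : Ptn n} {M : Type*} [AddCommMonoid M] [Module ℂ M]
    {F F' : MonoidAlgebra ℂ (Tabloid μ) →ₗ[ℂ] M}
    (h : ∀ s, F (MonoidAlgebra.single (Tabloid.mk s) 1) =
      F' (MonoidAlgebra.single (Tabloid.mk s) 1)) : F = F' :=
  MonoidAlgebra.lhom_ext' fun T => LinearMap.ext_ring <| by
    induction T using Tabloid.ind with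
    | h s => exact h s

theorem map_mem_of_map_tabloid_mem {μ : Ptn n} {M : Type*} [AddCommGroup M] [Module ℂ M]
    (F : MonoidAlgebra ℂ (Tabloid μ) →ₗ[ℂ] M) {N : Submodule ℂ M}
    (h : ∀ s, F (MonoidAlgebra.single (Tabloid.mk s) 1) ∈ N) (v : MonoidAlgebra ℂ (Tabloid μ)) :
    F v ∈ N := by
  have hF : N.mkQ ∘ₗ F = 0 := tabloid_hom_ext fun s => (Submodule.Quotient.mk_eq_zero N).2 (h s)
  exact (Submodule.Quotient.mk_eq_zero N).1 (LinearMap.congr_fun hF v)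

/-! ### The dot product on tabloids -/

/-- The bilinear form on `M^μ` for which the tabloids are an orthonormal basis. -/
def dot (μ : Ptn n) :
    MonoidAlgebra ℂ (Tabloid μ) →ₗ[ℂ] MonoidAlgebra ℂ (Tabloid μ) →ₗ[ℂ] ℂ :=
  LinearMap.mk₂ ℂ (fun u v => u.coeff ⬝ᵥ v.coeff)
    (fun u u' v => add_dotProduct u.coeff u'.coeff v.coeff)
    (fun c u v => smul_dotProduct c u.coeff v.coeff)
    (fun u v v' => dotProduct_add u.coeff v.coeff v'.coeff)
    (fun c u v => dotProduct_smul c u.coeff v.coeff)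

theorem dot_apply (μ : Ptn n) (u v : MonoidAlgebra ℂ (Tabloid μ)) :
    dot μ u v = u.coeff ⬝ᵥ v.coeff := rfl

theorem dot_comm (μ : Ptn n) (u v : MonoidAlgebra ℂ (Tabloid μ)) : dot μ u v = dot μ v u :=
  dotProduct_comm u.coeff v.coeff

theorem dot_single (μ : Ptn n) (T : Tabloid μ) (v : MonoidAlgebra ℂ (Tabloid μ)) :
    dot μ (MonoidAlgebra.single T 1) v = v.coeff T := by
  classical
  rw [dot_apply, MonoidAlgebra.coeff_single, Finsupp.single_eq_pi_single, single_dotProduct,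
    one_mul]

theorem dot_act (μ : Ptn n) (σ : Equiv.Perm (Fin n)) (u v : MonoidAlgebra ℂ (Tabloid μ)) :
    dot μ (tabloidModule μ σ u) (tabloidModule μ σ v) = dot μ u v := by
  rw [dot_apply, dot_apply]
  refine Fintype.sum_equiv (MulAction.toPerm σ⁻¹) _ _ fun T => ?_
  rw [Representation.coeff_ofMulAction, Representation.coeff_ofMulAction]
  rfl

theorem dot_act_left (μ : Ptn n) (σ : Equiv.Perm (Fin n)) (u v : MonoidAlgebra ℂ (Tabloid μ)) :
    dot μ (tabloidModule μ σ u) v = dot μ u (tabloidModule μ σ⁻¹ v) := by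
  rw [← dot_act μ σ u, ← Module.End.mul_apply, ← map_mul, mul_inv_cancel, map_one,
    Module.End.one_apply]

/-! ### Signed column sums -/

/-- The sign of a permutation, as a complex number. -/
def sgn : Equiv.Perm (Fin n) →* ℂ :=
  (Int.castRingHom ℂ : ℤ →* ℂ).comp ((Units.coeHom ℤ).comp Equiv.Perm.sign)

theorem sgn_apply (σ : Equiv.Perm (Fin n)) : sgn σ = ((Equiv.Perm.sign σ : ℤ) : ℂ) := rfl

theorem sgn_mul_self (σ : Equiv.Perm (Fin n)) : sgn σ * sgn σ = 1 := by
  rw [sgn_apply, ← Int.cast_mul, Int.units_coe_mul_self, Int.cast_one]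

theorem sgn_inv (σ : Equiv.Perm (Fin n)) : sgn σ⁻¹ = sgn σ := by
  rw [sgn_apply, sgn_apply, Equiv.Perm.sign_inv]

section ColumnSum

variable {V : Type*} [AddCommGroup V] [Module ℂ V]

open scoped Classical in
/-- The signed sum over the column stabilizer of `t`, as an operator on a representation. -/
def columnSum {lam : Ptn n} (t : Tableau lam) (ρ : Representation ℂ (Equiv.Perm (Fin n)) V) :
    V →ₗ[ℂ] V :=
  ∑ π : colStab t, sgn π.1 • ρ π.1

open scoped Classical in
theorem columnSum_apply {lam : Ptn n} (t : Tableau lam)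
    (ρ : Representation ℂ (Equiv.Perm (Fin n)) V) (v : V) :
    columnSum t ρ v = ∑ π : colStab t, sgn π.1 • ρ π.1 v := by
  rw [columnSum, LinearMap.sum_apply]
  rfl

theorem columnSum_single {lam : Ptn n} (t : Tableau lam) :
    columnSum t (tabloidModule lam) (MonoidAlgebra.single (Tabloid.mk t) 1) = polytabloid t := by
  classical
  rw [columnSum_apply, polytabloid]
  refine Fintype.sum_equiv (Equiv.refl _) _ _ fun π => ?_
  rw [Representation.ofMulAction_single, smul_mk]
  rfl

theorem columnSum_act {lam : Ptn n} (t : Tableau lam)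
    (ρ : Representation ℂ (Equiv.Perm (Fin n)) V) {τ : Equiv.Perm (Fin n)} (hτ : τ ∈ colStab t)
    (v : V) : columnSum t ρ (ρ τ v) = sgn τ • columnSum t ρ v := by
  classical
  rw [columnSum_apply, columnSum_apply, Finset.smul_sum]
  refine Fintype.sum_equiv (Equiv.mulRight ⟨τ, hτ⟩) _ _ fun π => ?_
  rw [Equiv.coe_mulRight, Subgroup.coe_mul, map_mul, map_mul, smul_smul, mul_left_comm,
    sgn_mul_self, mul_one, Module.End.mul_apply]

theorem act_columnSum {lam : Ptn n} (t : Tableau lam)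
    (ρ : Representation ℂ (Equiv.Perm (Fin n)) V) {τ : Equiv.Perm (Fin n)} (hτ : τ ∈ colStab t)
    (v : V) : ρ τ (columnSum t ρ v) = sgn τ • columnSum t ρ v := by
  classical
  rw [columnSum_apply, Finset.smul_sum, map_sum]
  refine Fintype.sum_equiv (Equiv.mulLeft ⟨τ, hτ⟩) _ _ fun π => ?_
  rw [Equiv.coe_mulLeft, Subgroup.coe_mul, map_mul, map_mul, smul_smul, ← mul_assoc,
    sgn_mul_self, one_mul, map_smul, Module.End.mul_apply]

theorem polytabloid_act {lam : Ptn n} (t : Tableau lam) {τ : Equiv.Perm (Fin n)}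
    (hτ : τ ∈ colStab t) : polytabloid (t.act τ) = sgn τ • polytabloid t := by
  rw [← tabloidModule_polytabloid, ← columnSum_single, act_columnSum t _ hτ]

theorem dot_columnSum {lam μ : Ptn n} (t : Tableau lam) (u v : MonoidAlgebra ℂ (Tabloid μ)) :
    dot μ (columnSum t (tabloidModule μ) u) v = dot μ u (columnSum t (tabloidModule μ) v) := by
  classical
  rw [columnSum_apply, columnSum_apply, map_sum, map_sum, LinearMap.sum_apply]
  refine Fintype.sum_equiv (Equiv.inv _) _ _ fun π => ?_
  rw [map_smul, map_smul, LinearMap.smul_apply, dot_act_left, Equiv.inv_apply, Subgroup.coe_inv,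
    sgn_inv]

end ColumnSum

/-! ### Dominance -/

/-- The number of boxes in the first `j` rows; these numbers define the dominance order. -/
def boxesAbove (μ : Ptn n) (j : ℕ) : ℕ := (μ.1.cells.filter fun c => c.1 < j).card

theorem card_row_lt {μ : Ptn n} (s : Tableau μ) (j : ℕ) :
    (Finset.univ.filter fun x => s.row x < j).card = boxesAbove μ j := by
  refine Finset.card_bij (fun x _ => (s x).1) ?_ ?_ ?_
  · intro x hx
    exact Finset.mem_filter.2 ⟨(s x).2, (Finset.mem_filter.1 hx).2⟩
  · intro x _ y _ h
    exact s.injective (Subtype.ext h)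
  · intro c hc
    obtain ⟨hc, hj⟩ := Finset.mem_filter.1 hc
    refine ⟨s.symm ⟨c, hc⟩, Finset.mem_filter.2 ⟨Finset.mem_univ _, ?_⟩, by simp⟩
    simpa [Tableau.row] using hj

theorem card_col_row_lt {μ : Ptn n} (t : Tableau μ) (c j : ℕ) :
    (Finset.univ.filter fun x => t.col x = c ∧ t.row x < j).card = min j (μ.1.colLen c) := by
  rw [← Finset.card_range (min j _)]
  refine Finset.card_bij (fun x _ => t.row x) ?_ ?_ ?_
  · intro x hx
    obtain ⟨-, rfl, hj⟩ := Finset.mem_filter.1 hx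
    rw [Finset.mem_range, lt_min_iff]
    exact ⟨hj, YoungDiagram.mem_iff_lt_colLen.1 (t x).2⟩
  · intro x hx y hy h
    exact tableau_ext t h ((Finset.mem_filter.1 hx).2.1.trans (Finset.mem_filter.1 hy).2.1.symm)
  · intro i hi
    rw [Finset.mem_range, lt_min_iff] at hi
    have hc : (i, c) ∈ μ.1.cells := YoungDiagram.mem_iff_lt_colLen.2 hi.2
    refine ⟨t.symm ⟨(i, c), hc⟩, Finset.mem_filter.2 ⟨Finset.mem_univ _, ?_⟩, ?_⟩ <;>
      simp [Tableau.row, Tableau.col, hi.1]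

theorem row_lt_colLen {μ : Ptn n} (t : Tableau μ) (x : Fin n) :
    t.row x < μ.1.colLen (t.col x) :=
  YoungDiagram.mem_iff_lt_colLen.1 (t x).2

theorem card_col {μ : Ptn n} (t : Tableau μ) (c : ℕ) :
    (Finset.univ.filter fun x => t.col x = c).card = μ.1.colLen c := by
  rw [← min_self (μ.1.colLen c), ← card_col_row_lt t]
  congr 1
  refine Finset.filter_congr fun x _ => ⟨fun h => ⟨h, h ▸ row_lt_colLen t x⟩, fun h => h.1⟩

section Separated

variable {lam μ : Ptn n} (t : Tableau lam) (s : Tableau μ)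

/-- Entries in the same column of `t` are in different rows of `s`. This is the case exactly if the
signed column sum of `t` does not annihilate the tabloid of `s`. -/
def Separated : Prop := ∀ x y, t.col x = t.col y → s.row x = s.row y → x = y

variable {t s}

theorem Separated.card_le (h : Separated t s) (c j : ℕ) :
    (Finset.univ.filter fun x => t.col x = c ∧ s.row x < j).card ≤
      (Finset.univ.filter fun x => t.col x = c ∧ t.row x < j).card := by
  rw [card_col_row_lt, le_min_iff]
  constructor
  · refine (Finset.card_le_card_of_injOn (t := Finset.range j) s.row ?_ ?_).trans_eq
      (Finset.card_range j)
    · intro x hx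
      exact Finset.mem_coe.2 (Finset.mem_range.2 (Finset.mem_filter.1 (Finset.mem_coe.1 hx)).2.2)
    · intro x hx y hy hxy
      exact h x y ((Finset.mem_filter.1 (Finset.mem_coe.1 hx)).2.1.trans
        (Finset.mem_filter.1 (Finset.mem_coe.1 hy)).2.1.symm) hxy
  · rw [← card_col t c]
    exact Finset.card_le_card fun x hx => by
      simp only [Finset.mem_filter] at hx ⊢
      exact ⟨hx.1, hx.2.1⟩

theorem card_eq_sum_col (t : Tableau lam) (p : Fin n → Prop) [DecidablePred p] :
    (Finset.univ.filter p).card = ∑ c ∈ Finset.univ.image t.col,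
      (Finset.univ.filter fun x => t.col x = c ∧ p x).card := by
  rw [Finset.card_eq_sum_card_fiberwise (f := t.col) (t := Finset.univ.image t.col)
    fun x _ => by simp]
  refine Finset.sum_congr rfl fun c _ => ?_
  rw [Finset.filter_filter]
  simp only [and_comm]

theorem Separated.boxesAbove_le (h : Separated t s) (j : ℕ) :
    boxesAbove μ j ≤ boxesAbove lam j := by
  rw [← card_row_lt s, ← card_row_lt t, card_eq_sum_col t, card_eq_sum_col t]
  exact Finset.sum_le_sum fun c _ => h.card_le c j

theorem Separated.row_lt_colLen {s : Tableau lam} (h : Separated t s) (x : Fin n) :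
    s.row x < lam.1.colLen (t.col x) := by
  set j := lam.1.colLen (t.col x)
  have hcard := (card_row_lt s j).trans (card_row_lt t j).symm
  rw [card_eq_sum_col t, card_eq_sum_col t,
    Finset.sum_eq_sum_iff_of_le fun c _ => h.card_le c j] at hcard
  have hcol : (Finset.univ.filter fun y => t.col y = t.col x ∧ s.row y < j).card =
      (Finset.univ.filter fun y => t.col y = t.col x).card := by
    rw [hcard _ (Finset.mem_image_of_mem _ (Finset.mem_univ x)), card_col_row_lt, min_self,
      card_col]
  exact (Finset.card_filter_eq_iff.1 ((congrArg _ (Finset.filter_filter _ _ _)).trans hcol) x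
    (Finset.mem_filter.2 ⟨Finset.mem_univ x, rfl⟩))

theorem Separated.exists_colStab {s : Tableau lam} (h : Separated t s) :
    ∃ π ∈ colStab t, Tabloid.mk s = Tabloid.mk (t.act π) := by
  let f : Fin n → {c : ℕ × ℕ // c ∈ lam.1.cells} := fun x =>
    ⟨(s.row x, t.col x), YoungDiagram.mem_iff_lt_colLen.2 (h.row_lt_colLen x)⟩
  have hf : Function.Bijective f := by
    rw [Fintype.bijective_iff_injective_and_card, card_cells, Fintype.card_fin]
    refine ⟨fun x y hxy => ?_, rfl⟩
    obtain ⟨hrow, hcol⟩ := Prod.mk.inj (congrArg Subtype.val hxy)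
    exact h x y hcol hrow
  let t' : Tableau lam := Equiv.ofBijective f hf
  have ht' : t.act (t.trans t'.symm) = t' := Equiv.ext fun x => by simp [Tableau.act]
  refine ⟨t.trans t'.symm, fun x => ?_, ?_⟩
  · change t'.col (t'.symm (t x)) = _
    rw [Tableau.col, Equiv.apply_symm_apply]
    rfl
  · rw [ht']
    exact Quotient.sound fun x => rfl

theorem columnSum_single_eq_zero (h : ¬ Separated t s) :
    columnSum t (tabloidModule μ) (MonoidAlgebra.single (Tabloid.mk s) 1) = 0 := by
  simp only [Separated, not_forall] at h
  obtain ⟨x, y, hc, hr, hxy⟩ := h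
  have hmem : Equiv.swap x y ∈ colStab t := Equiv.apply_swap_eq_self hc
  have hfix : Tabloid.mk (s.act (Equiv.swap x y)) = Tabloid.mk s :=
    Quotient.sound (Equiv.apply_swap_eq_self hr)
  have hneg := columnSum_act t (tabloidModule μ) hmem (MonoidAlgebra.single (Tabloid.mk s) 1)
  rw [Representation.ofMulAction_single, smul_mk, hfix, sgn_apply, Equiv.Perm.sign_swap hxy,
    Units.val_neg, Units.val_one, Int.cast_neg, Int.cast_one, neg_one_smul] at hneg
  refine (smul_eq_zero.1 ?_).resolve_left (two_ne_zero (α := ℂ))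
  rw [two_smul]
  exact add_eq_zero_iff_eq_neg.2 hneg

theorem columnSum_eq_zero (t : Tableau lam) {j : ℕ} (h : boxesAbove lam j < boxesAbove μ j) :
    columnSum t (tabloidModule μ) = 0 :=
  tabloid_hom_ext fun _ => columnSum_single_eq_zero fun hs => (hs.boxesAbove_le j).not_gt h

end Separated

theorem boxesAbove_injective : Function.Injective (boxesAbove : Ptn n → ℕ → ℕ) := by
  intro lam μ h
  have hrow (ν : Ptn n) (i : ℕ) : boxesAbove ν (i + 1) = boxesAbove ν i + ν.1.rowLen i := by
    rw [boxesAbove, boxesAbove, YoungDiagram.rowLen_eq_card, ← Finset.card_union_of_disjoint]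
    · congr 1
      ext c
      simp only [Finset.mem_filter, Finset.mem_union, YoungDiagram.mem_row_iff,
        YoungDiagram.mem_cells, Nat.lt_succ_iff_lt_or_eq]
      tauto
    · rw [Finset.disjoint_left]
      intro c hc hc'
      rw [YoungDiagram.mem_row_iff] at hc'
      exact absurd (Finset.mem_filter.1 hc).2 (by omega)
  have hlen (i : ℕ) : lam.1.rowLen i = μ.1.rowLen i := by
    exact Nat.add_left_cancel ((hrow lam i).symm.trans (h ▸ hrow μ i))
  refine Subtype.ext (YoungDiagram.ext (Finset.ext fun ⟨i, j⟩ => ?_))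
  rw [YoungDiagram.mem_cells, YoungDiagram.mem_cells, YoungDiagram.mem_iff_lt_rowLen,
    YoungDiagram.mem_iff_lt_rowLen, hlen]

theorem coeff_polytabloid_self {lam : Ptn n} (t : Tableau lam) :
    (polytabloid t).coeff (Tabloid.mk t) = 1 := by
  classical
  rw [← dot_single, polytabloid, map_sum, Finset.sum_eq_single 1]
  · rw [map_smul, dot_single, OneMemClass.coe_one, map_one, Units.val_one, Int.cast_one, one_smul]
    simp [Tableau.act, Equiv.Perm.one_def]
  · intro π _ hπ
    rw [map_smul, dot_single, MonoidAlgebra.coeff_single, Finsupp.single_apply, if_neg, smul_zero]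
    intro h
    refine hπ (Subtype.ext (Equiv.ext fun x => ?_))
    have hrow : t.row (π.1.symm (π.1 x)) = t.row (π.1 x) := Quotient.exact h (π.1 x)
    rw [Equiv.symm_apply_apply] at hrow
    exact tableau_ext t hrow.symm (π.2 x)
  · simp

theorem columnSum_eq {lam : Ptn n} (t : Tableau lam) (m : MonoidAlgebra ℂ (Tabloid lam)) :
    columnSum t (tabloidModule lam) m = dot lam m (polytabloid t) • polytabloid t := by
  have hspan : columnSum t (tabloidModule lam) m ∈ Submodule.span ℂ {polytabloid t} := by
    refine map_mem_of_map_tabloid_mem _ (fun s => ?_) m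
    by_cases hs : Separated t s
    · obtain ⟨π, hπ, h⟩ := hs.exists_colStab
      rw [h, ← smul_mk, ← Representation.ofMulAction_single, columnSum_act t _ hπ,
        columnSum_single]
      exact Submodule.smul_mem _ _ (Submodule.mem_span_singleton_self _)
    · rw [columnSum_single_eq_zero hs]
      exact Submodule.zero_mem _
  obtain ⟨c, hc⟩ := Submodule.mem_span_singleton.1 hspan
  rw [← hc]
  congr 1
  rw [dot_comm, ← columnSum_single, dot_columnSum, ← hc, dot_single, MonoidAlgebra.coeff_smul,
    Finsupp.smul_apply, coeff_polytabloid_self, smul_eq_mul, mul_one]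

/-! ### Nondegeneracy and irreducibility -/

theorem star_coeff_polytabloid {lam : Ptn n} (t : Tableau lam) :
    star (⇑(polytabloid t).coeff) = (polytabloid t).coeff := by
  classical
  funext T
  rw [Pi.star_apply, ← dot_single, polytabloid, map_sum, star_sum]
  refine Finset.sum_congr rfl fun π _ => ?_
  rw [map_smul, dot_single, MonoidAlgebra.coeff_single, Finsupp.single_apply, smul_eq_mul,
    star_mul', star_intCast]
  split_ifs <;> simp

open scoped ComplexOrder in
/-- The polytabloids have real coefficients, so their span meets its orthogonal space with respect
to the bilinear form only where the Hermitian form vanishes. -/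
theorem eq_zero_of_dot_polytabloid {lam : Ptn n} {v : MonoidAlgebra ℂ (Tabloid lam)}
    (hv : v ∈ (spechtSub lam).toSubmodule) (h : ∀ t, dot lam v (polytabloid t) = 0) : v = 0 := by
  have horth : ∀ w ∈ (spechtSub lam).toSubmodule, v.coeff ⬝ᵥ star (⇑w.coeff) = 0 := by
    intro w hw
    refine Submodule.span_induction ?_ ?_ (fun w w' _ _ hw hw' => ?_) (fun c w _ hw => ?_) hw
    · rintro _ ⟨t, rfl⟩
      rw [star_coeff_polytabloid]
      exact h t
    · exact (congrArg _ (star_zero _)).trans (dotProduct_zero _)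
    · rw [MonoidAlgebra.coeff_add, Finsupp.coe_add, star_add, dotProduct_add, hw, hw', add_zero]
    · rw [MonoidAlgebra.coeff_smul, Finsupp.coe_smul, star_smul, dotProduct_smul, hw, smul_zero]
  exact MonoidAlgebra.ext (DFunLike.coe_injective (dotProduct_self_star_eq_zero.1 (horth v hv)))

theorem polytabloid_ne_zero {lam : Ptn n} (t : Tableau lam) : polytabloid t ≠ 0 := by
  intro h
  have hcoeff := coeff_polytabloid_self t
  rw [h] at hcoeff
  exact zero_ne_one hcoeff

open scoped ComplexOrder in
theorem dot_polytabloid_self_ne_zero {lam : Ptn n} (t : Tableau lam) :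
    dot lam (polytabloid t) (polytabloid t) ≠ 0 := by
  intro h
  refine polytabloid_ne_zero t (MonoidAlgebra.ext (DFunLike.coe_injective ?_))
  exact dotProduct_self_star_eq_zero.1 ((congrArg _ (star_coeff_polytabloid t)).trans h)

theorem span_spechtPolytabloid (lam : Ptn n) :
    Submodule.span ℂ (Set.range (spechtPolytabloid (μ := lam))) = ⊤ := by
  refine Submodule.map_injective_of_injective (spechtSub lam).toSubmodule.injective_subtype ?_
  rw [Submodule.map_span, ← Set.range_comp, Submodule.map_subtype_top]
  rfl

theorem specht_spechtPolytabloid {lam : Ptn n} (σ : Equiv.Perm (Fin n)) (t : Tableau lam) :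
    specht lam σ (spechtPolytabloid t) = spechtPolytabloid (t.act σ) :=
  Subtype.ext (tabloidModule_polytabloid σ t)

theorem columnSum_specht {lam : Ptn n} (t : Tableau lam) (v : (spechtSub lam).toSubmodule) :
    columnSum t (specht lam) v = dot lam v (polytabloid t) • spechtPolytabloid t := by
  classical
  refine Subtype.ext ((?_ : _ = _).trans (columnSum_eq t v))
  rw [columnSum_apply, columnSum_apply, AddSubmonoidClass.coe_finsetSum]
  rfl

instance isIrreducible_specht (lam : Ptn n) : (specht lam).IsIrreducible where
  exists_pair_ne := by
    refine ⟨⊥, ⊤, fun h => polytabloid_ne_zero (Classical.arbitrary (Tableau lam)) ?_⟩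
    have hmem : spechtPolytabloid (Classical.arbitrary (Tableau lam)) ∈
        (⊥ : Subrepresentation (specht lam)).toSubmodule := h ▸ Submodule.mem_top
    exact congrArg Subtype.val ((Submodule.mem_bot ℂ).1 hmem)
  eq_bot_or_eq_top N := by
    classical
    refine or_iff_not_imp_left.2 fun hN => Subrepresentation.toSubmodule_injective (top_le_iff.1 ?_)
    obtain ⟨v, hv, hv₀⟩ := Submodule.exists_mem_ne_zero_of_ne_bot
      fun h => hN (Subrepresentation.toSubmodule_injective h)
    obtain ⟨t, ht⟩ : ∃ t, dot lam v (polytabloid t) ≠ 0 := by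
      by_contra! h
      exact hv₀ (Subtype.ext (eq_zero_of_dot_polytabloid v.2 h))
    have htN : spechtPolytabloid t ∈ N.toSubmodule := by
      rw [← N.toSubmodule.smul_mem_iff ht, ← columnSum_specht, columnSum_apply]
      exact Submodule.sum_mem _ fun π _ =>
        N.toSubmodule.smul_mem _ (N.apply_mem_toSubmodule π.1 hv)
    refine (span_spechtPolytabloid lam).ge.trans (Submodule.span_le.2 ?_)
    rintro _ ⟨s, rfl⟩
    obtain ⟨σ, rfl⟩ := exists_act_eq t s
    exact specht_spechtPolytabloid σ t ▸ N.apply_mem_toSubmodule σ htN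

/-! ### The sign twist -/

/-- The transposed tableau. -/
def Tableau.transpose {lam : Ptn n} (t : Tableau lam.conj) : Tableau lam :=
  t.trans ((Equiv.prodComm ℕ ℕ).subtypeEquiv fun c => by
    rw [YoungDiagram.mem_cells, YoungDiagram.mem_cells]
    exact YoungDiagram.mem_transpose)

theorem Tableau.transpose_act {lam : Ptn n} (t : Tableau lam.conj) (σ : Equiv.Perm (Fin n)) :
    (t.act σ).transpose = t.transpose.act σ := rfl

/-- A chosen `lam`-tableau, relative to which the signs of tableaux are taken. -/
def refTableau (lam : Ptn n) : Tableau lam := Classical.arbitrary _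

/-- The sign of the permutation that sends the reference tableau to `t`. -/
def tableauSign {lam : Ptn n} (t : Tableau lam) : ℂ :=
  sgn ((refTableau lam).trans t.symm : Equiv.Perm (Fin n))

theorem tableauSign_act {lam : Ptn n} (t : Tableau lam) (σ : Equiv.Perm (Fin n)) :
    tableauSign (t.act σ) = sgn σ * tableauSign t := by
  rw [tableauSign, tableauSign, ← map_mul]
  rfl

theorem tableauSign_ne_zero {lam : Ptn n} (t : Tableau lam) : tableauSign t ≠ 0 :=
  left_ne_zero_of_mul_eq_one (sgn_mul_self _)

/-- The polytabloid of the transposed tableau times the sign of the tableau. Row equivalent tableaux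
give the same element, since rows become columns. -/
def signedTranspose (lam : Ptn n) (T : Tabloid lam.conj) : MonoidAlgebra ℂ (Tabloid lam) :=
  Quotient.lift (fun t : Tableau lam.conj => tableauSign t • polytabloid t.transpose) (by
    intro t s h
    obtain ⟨π, rfl⟩ := exists_act_eq t s
    have hπ : π ∈ colStab t.transpose := by
      intro x
      have hrow : t.row (π x) = t.row (π.symm (π x)) := h (π x)
      rwa [Equiv.symm_apply_apply] at hrow
    rw [tableauSign_act, Tableau.transpose_act, polytabloid_act _ hπ, smul_smul, mul_right_comm,
      sgn_mul_self, one_mul]) T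

theorem signedTranspose_mk {lam : Ptn n} (t : Tableau lam.conj) :
    signedTranspose lam (Tabloid.mk t) = tableauSign t • polytabloid t.transpose := rfl

/-- The map `M^{lam'} → M^lam` that extends `signedTranspose`; it is equivariant up to the sign
character. -/
def twistTabloid (lam : Ptn n) :
    MonoidAlgebra ℂ (Tabloid lam.conj) →ₗ[ℂ] MonoidAlgebra ℂ (Tabloid lam) :=
  Finsupp.linearCombination ℂ (signedTranspose lam) ∘ₗ
    (MonoidAlgebra.coeffLinearEquiv ℂ).toLinearMap

theorem twistTabloid_single {lam : Ptn n} (t : Tableau lam.conj) :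
    twistTabloid lam (MonoidAlgebra.single (Tabloid.mk t) 1) =
      tableauSign t • polytabloid t.transpose := by
  rw [← signedTranspose_mk]
  simp [twistTabloid]

theorem twistTabloid_act (lam : Ptn n) (σ : Equiv.Perm (Fin n)) :
    twistTabloid lam ∘ₗ tabloidModule lam.conj σ =
      twist sgn (tabloidModule lam) σ ∘ₗ twistTabloid lam :=
  tabloid_hom_ext fun t => by
    simp only [LinearMap.comp_apply, twist_apply]
    rw [Representation.ofMulAction_single, smul_mk, twistTabloid_single, twistTabloid_single,
      tableauSign_act, Tableau.transpose_act, map_smul, tabloidModule_polytabloid, smul_smul]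

theorem twistTabloid_mem (lam : Ptn n) (v : MonoidAlgebra ℂ (Tabloid lam.conj)) :
    twistTabloid lam v ∈ (spechtSub lam).toSubmodule :=
  map_mem_of_map_tabloid_mem _ (fun t => by
    rw [twistTabloid_single]
    exact Submodule.smul_mem _ _ (Submodule.subset_span ⟨_, rfl⟩)) v

theorem twistTabloid_polytabloid_ne_zero {lam : Ptn n} (t : Tableau lam.conj) :
    twistTabloid lam (polytabloid t) ≠ 0 := by
  classical
  intro h
  have hdot : dot lam (MonoidAlgebra.single (Tabloid.mk t.transpose) 1)
      (twistTabloid lam (polytabloid t)) = Fintype.card (colStab t) * tableauSign t := by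
    rw [← columnSum_single, columnSum_apply, map_sum, map_sum, ← nsmul_eq_mul, ← Finset.card_univ]
    refine Finset.sum_eq_card_nsmul fun π _ => ?_
    have hrow : Tabloid.mk (t.transpose.act π.1⁻¹) = Tabloid.mk t.transpose :=
      Quotient.sound fun x => π.2 x
    have hact := LinearMap.congr_fun (twistTabloid_act lam π.1)
      (MonoidAlgebra.single (Tabloid.mk t) 1)
    rw [LinearMap.comp_apply, LinearMap.comp_apply, twist_apply] at hact
    rw [map_smul, hact, smul_smul, sgn_mul_self, one_smul, twistTabloid_single, map_smul, map_smul,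
      dot_single, Representation.coeff_ofMulAction, smul_mk, hrow, coeff_polytabloid_self,
      smul_eq_mul, mul_one]
  rw [h, map_zero, eq_comm, mul_eq_zero] at hdot
  exact hdot.elim (Nat.cast_ne_zero.2 Fintype.card_ne_zero) (tableauSign_ne_zero t)

/-- The restriction of `twistTabloid` to the Specht modules. -/
def spechtTwist (lam : Ptn n) : (specht lam.conj).IntertwiningMap (twist sgn (specht lam)) where
  toLinearMap := (twistTabloid lam ∘ₗ (spechtSub lam.conj).toSubmodule.subtype).codRestrict _
    fun v => twistTabloid_mem lam v
  isIntertwining' σ := LinearMap.ext fun v =>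
    Subtype.ext (LinearMap.congr_fun (twistTabloid_act lam σ) v)

theorem nonempty_specht_conj_equiv_twist (lam : Ptn n) :
    Nonempty ((specht lam.conj).Equiv (twist sgn (specht lam))) := by
  refine (Representation.IsIrreducible.bijective_or_eq_zero (spechtTwist lam)).elim
    (fun h => ⟨(spechtTwist lam).ofBijective h⟩) fun h => ?_
  refine (twistTabloid_polytabloid_ne_zero (refTableau lam.conj) ?_).elim
  exact congrArg Subtype.val
    (congrArg (fun f => f.toLinearMap (spechtPolytabloid (refTableau lam.conj))) h)

/-! ### Counting partitions -/

instance : Finite (Ptn n) := by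
  refine Finite.of_injective (β := ((Finset.range n ×ˢ Finset.range n).powerset))
    (fun μ => ⟨μ.1.cells, Finset.mem_powerset.2 fun c hc => ?_⟩) fun μ ν h =>
      Subtype.ext (YoungDiagram.ext (congrArg Subtype.val h))
  have hc' : (c.1, c.2) ∈ μ.1 := hc
  have hμ := μ.2
  rw [Finset.mem_product, Finset.mem_range, Finset.mem_range]
  constructor
  · refine (YoungDiagram.mem_iff_lt_colLen.1 hc').trans_le ?_
    rw [YoungDiagram.colLen_eq_card]
    exact (Finset.card_le_card (Finset.filter_subset _ _)).trans_eq hμ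
  · refine (YoungDiagram.mem_iff_lt_rowLen.1 hc').trans_le ?_
    rw [YoungDiagram.rowLen_eq_card]
    exact (Finset.card_le_card (Finset.filter_subset _ _)).trans_eq hμ

instance : Fintype (Ptn n) := Fintype.ofFinite _

theorem card_cellsOfRowLens (w : List ℕ) : (YoungDiagram.cellsOfRowLens w).card = w.sum := by
  induction w with
  | nil => rfl
  | cons a w ih =>
    rw [YoungDiagram.cellsOfRowLens, Finset.card_union_of_disjoint, Finset.card_map, ih,
      Finset.card_product, Finset.card_singleton, one_mul, Finset.card_range, List.sum_cons]
    rw [Finset.disjoint_left]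
    rintro ⟨i, j⟩ h h'
    simp only [Finset.mem_product, Finset.mem_singleton] at h
    simp [h.1] at h'

/-- The Young diagram of a partition. -/
def ofPartition (p : n.Partition) : Ptn n :=
  ⟨YoungDiagram.ofRowLens (p.parts.sort (· ≥ ·)) (Multiset.pairwise_sort _ _).sortedGE, by
    refine (card_cellsOfRowLens _).trans ?_
    rw [← Multiset.sum_coe, Multiset.sort_eq, p.parts_sum]⟩

theorem ofPartition_injective : Function.Injective (ofPartition : n.Partition → Ptn n) := by
  intro p q h
  have hp (p : n.Partition) : (ofPartition p).1.rowLens = p.parts.sort (· ≥ ·) :=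
    YoungDiagram.rowLens_ofRowLens_eq_self (hw := (Multiset.pairwise_sort _ _).sortedGE)
      fun x hx => p.parts_pos ((Multiset.mem_sort _).1 hx)
  have hsort := (hp p).symm.trans ((congrArg (fun μ : Ptn n => μ.1.rowLens) h).trans (hp q))
  refine Nat.Partition.ext ?_
  rw [← Multiset.sort_eq p.parts (· ≥ ·), hsort, Multiset.sort_eq]

theorem card_conjClasses_le [Fintype (ConjClasses (Equiv.Perm (Fin n)))] :
    Fintype.card (ConjClasses (Equiv.Perm (Fin n))) ≤ Fintype.card (Ptn n) := by
  let f : ConjClasses (Equiv.Perm (Fin n)) → (Fintype.card (Fin n)).Partition :=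
    Quotient.lift Equiv.Perm.partition fun σ τ h => Equiv.Perm.partition_eq_of_isConj.1 h
  have hf : Function.Injective f := by
    rintro ⟨σ⟩ ⟨τ⟩ h
    exact Quotient.sound (Equiv.Perm.partition_eq_of_isConj.2 h)
  refine (Fintype.card_le_of_injective _ (ofPartition_injective.comp hf)).trans_eq ?_
  rw [Fintype.card_fin]

/-! ### The Peter–Weyl decomposition of `S_n` -/

/-- The matrix coefficients of `S^lam`: the image of `u ⊗ v` is the function `g ↦ ⟨u, g v⟩`. -/
def matCoeff (lam : Ptn n) : (spechtSub lam).toSubmodule ⊗[ℂ] (spechtSub lam).toSubmodule →ₗ[ℂ]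
    (Equiv.Perm (Fin n) → ℂ) :=
  TensorProduct.lift (LinearMap.mk₂ ℂ
    (fun u v g => dot lam u (tabloidModule lam g v))
    (fun u u' v => funext fun g => by simp)
    (fun c u v => funext fun g => by simp)
    (fun u v v' => funext fun g => by simp)
    (fun c u v => funext fun g => by simp))

theorem matCoeff_tmul (lam : Ptn n) (u v : (spechtSub lam).toSubmodule)
    (g : Equiv.Perm (Fin n)) :
    matCoeff lam (u ⊗ₜ v) g = dot lam u (tabloidModule lam g v) := rfl

open scoped Classical in
/-- The signed sum of the values of a function over a left coset of the column stabilizer of `t`. On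
matrix coefficients it acts as the signed column sum of `t`. -/
def columnEval {lam : Ptn n} (t : Tableau lam) (g : Equiv.Perm (Fin n)) :
    (Equiv.Perm (Fin n) → ℂ) →ₗ[ℂ] ℂ :=
  ∑ π : colStab t, sgn π.1 • LinearMap.proj (g * π.1)

theorem columnEval_matCoeff {lam μ : Ptn n} (t : Tableau lam) (g : Equiv.Perm (Fin n))
    (u v : (spechtSub μ).toSubmodule) :
    columnEval t g (matCoeff μ (u ⊗ₜ v)) =
      dot μ u (tabloidModule μ g (columnSum t (tabloidModule μ) v)) := by
  classical
  rw [columnEval, columnSum_apply, LinearMap.sum_apply, map_sum, map_sum]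
  refine Fintype.sum_equiv (Equiv.refl _) _ _ fun π => ?_
  rw [LinearMap.smul_apply, LinearMap.proj_apply, matCoeff_tmul, map_mul, Module.End.mul_apply,
    Equiv.refl_apply, map_smul, map_smul]

theorem columnEval_matCoeff_eq_zero {lam μ : Ptn n} (t : Tableau lam) (g : Equiv.Perm (Fin n))
    {j : ℕ} (h : boxesAbove lam j < boxesAbove μ j)
    (x : (spechtSub μ).toSubmodule ⊗[ℂ] (spechtSub μ).toSubmodule) :
    columnEval t g (matCoeff μ x) = 0 := by
  refine LinearMap.congr_fun (f := columnEval t g ∘ₗ matCoeff μ) (g := 0)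
    (TensorProduct.ext' fun u v => ?_) x
  rw [LinearMap.comp_apply, columnEval_matCoeff, columnSum_eq_zero t h, LinearMap.zero_apply,
    map_zero, map_zero, LinearMap.zero_apply]

/-- The dot products with the polytabloids, as redundant coordinates on the Specht module. -/
def polyCoords (lam : Ptn n) : (spechtSub lam).toSubmodule →ₗ[ℂ] (Tableau lam → ℂ) :=
  LinearMap.pi fun t => (dot lam).flip (polytabloid t) ∘ₗ (spechtSub lam).toSubmodule.subtype

theorem polyCoords_apply (lam : Ptn n) (v : (spechtSub lam).toSubmodule) (t : Tableau lam) :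
    polyCoords lam v t = dot lam v (polytabloid t) := rfl

theorem polyCoords_injective (lam : Ptn n) : Function.Injective (polyCoords lam) := by
  rw [injective_iff_map_eq_zero]
  exact fun v hv => Subtype.ext (eq_zero_of_dot_polytabloid v.2 fun t => congrFun hv t)

theorem eq_zero_of_columnEval {lam : Ptn n}
    {x : (spechtSub lam).toSubmodule ⊗[ℂ] (spechtSub lam).toSubmodule}
    (h : ∀ (t : Tableau lam) g, columnEval t g (matCoeff lam x) = 0) : x = 0 := by
  classical
  refine TensorProduct.map_injective_of_flat_flat _ _ (polyCoords_injective lam)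
    (polyCoords_injective lam) ?_
  refine (TensorProduct.piScalarRight ℂ ℂ (Tableau lam → ℂ) (Tableau lam)).injective ?_
  rw [map_zero, map_zero]
  funext t s
  obtain ⟨g, rfl⟩ := exists_act_eq t s
  rw [Pi.zero_apply, Pi.zero_apply, ← h t g]
  refine LinearMap.congr_fun (f := LinearMap.proj (t.act g) ∘ₗ LinearMap.proj t ∘ₗ
      (TensorProduct.piScalarRight ℂ ℂ (Tableau lam → ℂ) (Tableau lam)).toLinearMap ∘ₗ
        TensorProduct.map (polyCoords lam) (polyCoords lam))
    (g := columnEval t g ∘ₗ matCoeff lam) (TensorProduct.ext' fun u v => ?_) x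
  simp only [LinearMap.comp_apply, TensorProduct.map_tmul, LinearEquiv.coe_coe,
    columnEval_matCoeff, columnSum_eq, map_smul, tabloidModule_polytabloid]
  simp [polyCoords_apply]

/-- The Peter–Weyl map of `S_n`: it sends a family of tensors to the sum of their matrix
coefficients. -/
def peterWeyl (n : ℕ) :
    (⨁ lam : Ptn n, (spechtSub lam).toSubmodule ⊗[ℂ] (spechtSub lam).toSubmodule) →ₗ[ℂ]
      (Equiv.Perm (Fin n) → ℂ) :=
  ∑ lam : Ptn n, matCoeff lam ∘ₗ DirectSum.component ℂ (Ptn n)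
    (fun lam => (spechtSub lam).toSubmodule ⊗[ℂ] (spechtSub lam).toSubmodule) lam

theorem peterWeyl_apply
    (x : ⨁ lam : Ptn n, (spechtSub lam).toSubmodule ⊗[ℂ] (spechtSub lam).toSubmodule) :
    peterWeyl n x = ∑ lam : Ptn n, matCoeff lam (x lam) := by
  rw [peterWeyl, LinearMap.sum_apply]
  rfl

theorem peterWeyl_lof [DecidableEq (Ptn n)] (lam : Ptn n)
    (x : (spechtSub lam).toSubmodule ⊗[ℂ] (spechtSub lam).toSubmodule) :
    peterWeyl n (DirectSum.lof ℂ (Ptn n)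
      (fun lam => (spechtSub lam).toSubmodule ⊗[ℂ] (spechtSub lam).toSubmodule) lam x) =
      matCoeff lam x := by
  rw [peterWeyl_apply, Finset.sum_eq_single lam]
  · rw [DirectSum.lof_apply]
  · intro μ _ hμ
    rw [DirectSum.lof_eq_of, DirectSum.of_eq_of_ne _ _ _ hμ, map_zero]
  · simp

theorem peterWeyl_injective (n : ℕ) : Function.Injective (peterWeyl n) := by
  classical
  let _ : AddCommGroup (⨁ lam : Ptn n,
      (spechtSub lam).toSubmodule ⊗[ℂ] (spechtSub lam).toSubmodule) :=
    Module.addCommMonoidToAddCommGroup ℂ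
  rw [injective_iff_map_eq_zero]
  intro x hx
  by_contra hx₀
  obtain ⟨lam₀, h₀⟩ : ∃ lam, x lam ≠ 0 := by
    by_contra! h
    exact hx₀ (DFinsupp.ext fun lam => by rw [h]; rfl)
  obtain ⟨lam, hlam⟩ := (Finset.univ.filter fun lam => x lam ≠ 0).exists_minimalFor boxesAbove
    ⟨lam₀, by simpa using h₀⟩
  refine (Finset.mem_filter.1 hlam.1).2 (eq_zero_of_columnEval fun t g => ?_)
  have heval := congrArg (columnEval t g) hx
  rw [peterWeyl_apply, map_sum, map_zero, Finset.sum_eq_single lam] at heval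
  · exact heval
  · intro μ _ hμ
    by_cases hxμ : x μ = 0
    · rw [hxμ, map_zero, map_zero]
    · obtain ⟨j, hj⟩ : ∃ j, boxesAbove lam j < boxesAbove μ j := by
        by_contra! hle
        refine hμ (boxesAbove_injective (le_antisymm hle (hlam.2 ?_ hle)))
        simpa using hxμ
      exact columnEval_matCoeff_eq_zero t g hj _
  · simp

theorem matCoeff_equivariant (lam : Ptn n) (h k g : Equiv.Perm (Fin n))
    (u v : (spechtSub lam).toSubmodule) :
    matCoeff lam (specht lam h u ⊗ₜ specht lam k v) g = matCoeff lam (u ⊗ₜ v) (h⁻¹ * g * k) := by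
  rw [matCoeff_tmul, matCoeff_tmul, map_mul, map_mul]
  change dot lam (tabloidModule lam h u) (tabloidModule lam g (tabloidModule lam k v)) = _
  rw [dot_act_left]
  rfl

theorem peterWeyl_equivariant (h k : Equiv.Perm (Fin n)) (q) (g : Equiv.Perm (Fin n)) :
    peterWeyl n (boxSum specht specht (h, k) q) g =
      peterWeyl n q (h⁻¹ * g * k) := by
  classical
  refine LinearMap.congr_fun (f := LinearMap.proj g ∘ₗ peterWeyl n ∘ₗ
      boxSum specht specht (h, k))
    (g := LinearMap.proj (h⁻¹ * g * k) ∘ₗ peterWeyl n)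
    (boxSum_hom_ext fun lam u v => ?_) q
  simp only [LinearMap.comp_apply, LinearMap.proj_apply]
  rw [boxSum_apply, boxSumMap_lof, TensorProduct.map_tmul, peterWeyl_lof, peterWeyl_lof,
    matCoeff_equivariant]

/-- The sum of the diagonal orbit of `e_t ⊗ e_t`, for a reference tableau `t`. Its matrix
coefficient is a nonzero class function, which plays the role of the character of `S^lam`. -/
def casimir (lam : Ptn n) : (spechtSub lam).toSubmodule ⊗[ℂ] (spechtSub lam).toSubmodule :=
  ∑ h : Equiv.Perm (Fin n), specht lam h (spechtPolytabloid (refTableau lam)) ⊗ₜ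
    specht lam h (spechtPolytabloid (refTableau lam))

theorem matCoeff_casimir_conj (lam : Ptn n) (k g : Equiv.Perm (Fin n)) :
    matCoeff lam (casimir lam) (k * g * k⁻¹) = matCoeff lam (casimir lam) g := by
  rw [casimir, map_sum, Finset.sum_apply, Finset.sum_apply]
  refine Fintype.sum_equiv (Equiv.mulLeft k⁻¹) _ _ fun h => ?_
  have hconj : h⁻¹ * (k * g * k⁻¹) * h = (k⁻¹ * h)⁻¹ * g * (k⁻¹ * h) := by group
  rw [matCoeff_equivariant, Equiv.coe_mulLeft, matCoeff_equivariant, hconj]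

theorem matCoeff_casimir_ne_zero (lam : Ptn n) : matCoeff lam (casimir lam) 1 ≠ 0 := by
  rw [casimir, map_sum, Finset.sum_apply]
  simp only [matCoeff_equivariant, mul_one, inv_mul_cancel]
  rw [Finset.sum_const, matCoeff_tmul, map_one, Module.End.one_apply]
  exact smul_ne_zero (by simp [Fintype.card_ne_zero]) (dot_polytabloid_self_ne_zero _)

/-- The matrix coefficient of `casimir lam`, as a function on the conjugacy classes. -/
def classCoeff (lam : Ptn n) : ConjClasses (Equiv.Perm (Fin n)) → ℂ :=
  Quotient.lift (matCoeff lam (casimir lam)) fun σ τ h => by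
    obtain ⟨k, rfl⟩ := isConj_iff.1 (show IsConj σ τ from h)
    exact (matCoeff_casimir_conj lam k σ).symm

theorem linearIndependent_classCoeff :
    LinearIndependent ℂ (classCoeff : Ptn n → ConjClasses (Equiv.Perm (Fin n)) → ℂ) := by
  classical
  rw [Fintype.linearIndependent_iff]
  intro c hc lam
  have hzero : peterWeyl n (∑ μ, c μ • DirectSum.lof ℂ (Ptn n)
      (fun μ => (spechtSub μ).toSubmodule ⊗[ℂ] (spechtSub μ).toSubmodule) μ (casimir μ)) = 0 := by
    rw [map_sum]
    simp only [map_smul, peterWeyl_lof]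
    funext g
    have hcg := congrFun hc (ConjClasses.mk g)
    simp only [Finset.sum_apply, Pi.smul_apply] at hcg ⊢
    exact hcg
  have hlam := congrArg (fun x => DirectSum.component ℂ (Ptn n)
      (fun μ => (spechtSub μ).toSubmodule ⊗[ℂ] (spechtSub μ).toSubmodule) lam x)
    (peterWeyl_injective n (hzero.trans (map_zero _).symm))
  simp only [map_sum, map_smul, map_zero] at hlam
  rw [Finset.sum_eq_single lam, DirectSum.component.lof_self] at hlam
  · refine (smul_eq_zero.1 hlam).resolve_right fun hcas => matCoeff_casimir_ne_zero lam ?_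
    rw [hcas, map_zero, Pi.zero_apply]
  · intro μ _ hμ
    rw [DirectSum.component.of, dif_neg hμ, smul_zero]
  · simp

theorem span_classCoeff (n : ℕ) : Submodule.span ℂ (Set.range (classCoeff (n := n))) = ⊤ := by
  let _ : Fintype (ConjClasses (Equiv.Perm (Fin n))) := Fintype.ofFinite _
  refine linearIndependent_classCoeff.span_eq_top_of_card_eq_finrank' (le_antisymm ?_ ?_)
  · exact linearIndependent_classCoeff.fintype_card_le_finrank
  · rw [Module.finrank_fintype_fun_eq_card]
    exact card_conjClasses_le

theorem comp_mk_mem_range_peterWeyl (f : ConjClasses (Equiv.Perm (Fin n)) → ℂ) :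
    (fun g => f (ConjClasses.mk g)) ∈ LinearMap.range (peterWeyl n) := by
  classical
  have hf : f ∈ Submodule.span ℂ (Set.range (classCoeff (n := n))) :=
    span_classCoeff n ▸ Submodule.mem_top
  refine Submodule.span_le (p := (LinearMap.range (peterWeyl n)).comap
    (LinearMap.funLeft ℂ ℂ ConjClasses.mk)).2 ?_ hf
  rintro _ ⟨lam, rfl⟩
  exact ⟨_, peterWeyl_lof lam (casimir lam)⟩

theorem exists_peterWeyl_boxSum_eq_single (n : ℕ) :
    ∃ q, ∀ h k, peterWeyl n (boxSum specht specht (h, k) q) = Pi.single (h * k⁻¹) 1 := by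
  classical
  obtain ⟨q, hq⟩ := comp_mk_mem_range_peterWeyl
    (Pi.single (ConjClasses.mk (1 : Equiv.Perm (Fin n))) 1)
  refine ⟨q, fun h k => funext fun g => ?_⟩
  have hiff : ConjClasses.mk (h⁻¹ * g * k) = ConjClasses.mk 1 ↔ g = h * k⁻¹ := by
    rw [ConjClasses.mk_eq_mk_iff_isConj, isConj_one_left, mul_eq_one_iff_eq_inv,
      inv_mul_eq_iff_eq_mul]
  rw [peterWeyl_equivariant, hq]
  simp only [Pi.single_apply, hiff]

theorem exists_isMonomialGenerator_boxSum_specht (n : ℕ) :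
    ∃ q, IsMonomialGenerator
      ((MonoidHom.id (Equiv.Perm (Fin n))).prod (MonoidHom.id (Equiv.Perm (Fin n)))).range 1
      (boxSum specht specht) q := by
  classical
  obtain ⟨q, hq⟩ := exists_peterWeyl_boxSum_eq_single n
  have hdelta : peterWeyl n q = Pi.single 1 1 := by
    have h := hq 1 1
    rwa [show ((1, 1) : Equiv.Perm (Fin n) × Equiv.Perm (Fin n)) = 1 from rfl, map_one,
      Module.End.one_apply, mul_inv_cancel] at h
  refine ⟨q, ?_, ?_, LinearMap.proj 1 ∘ₗ peterWeyl n, ?_, fun x hx => ?_⟩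
  · refine Submodule.map_injective_of_injective (peterWeyl_injective n) (le_antisymm
      (Submodule.map_mono le_top) ?_)
    refine le_top.trans ((Pi.basisFun ℂ (Equiv.Perm (Fin n))).span_eq.ge.trans
      (Submodule.span_le.2 ?_))
    rintro _ ⟨h, rfl⟩
    refine ⟨_, Submodule.subset_span ⟨(h, 1), rfl⟩, ?_⟩
    rw [hq, inv_one, mul_one, Pi.basisFun_apply]
  · rintro _ ⟨h, rfl⟩
    refine peterWeyl_injective n ?_
    rw [MonoidHom.one_apply, one_smul, hdelta]
    exact (hq h h).trans (by rw [mul_inv_cancel])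
  · rw [LinearMap.comp_apply, hdelta, LinearMap.proj_apply, Pi.single_eq_same]
    exact one_ne_zero
  · rw [LinearMap.comp_apply, LinearMap.proj_apply]
    refine (congrFun (hq x.1 x.2) 1).trans (Pi.single_eq_of_ne (fun h => hx ⟨x.1, ?_⟩) 1)
    exact Prod.ext rfl (mul_inv_eq_one.1 h.symm)

theorem exists_isMonomialGenerator_boxSum_conj_specht (n : ℕ) :
    ∃ q, IsMonomialGenerator
      ((MonoidHom.id (Equiv.Perm (Fin n))).prod (MonoidHom.id (Equiv.Perm (Fin n)))).range
      (sgn.comp (MonoidHom.fst _ _)) (boxSum (fun lam => specht lam.conj) specht) q := by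
  obtain ⟨q, hq⟩ := exists_isMonomialGenerator_boxSum_specht n
  have hsgn := hq.twist (sgn.comp (MonoidHom.fst _ _))
  rw [mul_one, ← boxSum_twist] at hsgn
  exact ⟨_, hsgn.map (boxSumCongrLeft
    (fun lam => (nonempty_specht_conj_equiv_twist lam).some) specht).symm⟩

end Specht

/-! ### The component `U_{(1^b),a}` -/

section Column

variable {b : ℕ}

theorem col_column (t : Tableau (column b)) (x : Fin b) : t.col x = 0 := by
  obtain ⟨i, -, hi⟩ := Finset.mem_map.1 (t x).2
  exact (congrArg Prod.snd hi).symm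

theorem specht_column_spechtPolytabloid (σ : Equiv.Perm (Fin b)) (t : Tableau (column b)) :
    specht (column b) σ (spechtPolytabloid t) = sgn σ • spechtPolytabloid t := by
  rw [specht_spechtPolytabloid]
  exact Subtype.ext (polytabloid_act t fun x => by rw [col_column, col_column])

theorem mem_column (i j : ℕ) : (i, j) ∈ (column b).1 ↔ i < b ∧ j = 0 := by
  rw [← YoungDiagram.mem_cells]
  simp only [column, Finset.mem_map, Finset.mem_range]
  constructor
  · rintro ⟨k, hk, hkij⟩
    obtain ⟨rfl, rfl⟩ := Prod.mk.inj (show (k, 0) = (i, j) from hkij)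
    exact ⟨hk, rfl⟩
  · rintro ⟨hi, rfl⟩
    exact ⟨i, hi, rfl⟩

theorem rowLens_column (b : ℕ) : (column b).1.rowLens = List.replicate b 1 := by
  have hcol : (column b).1.colLen 0 = b := by
    refine eq_of_forall_lt_iff fun i => ?_
    rw [← YoungDiagram.mem_iff_lt_colLen, mem_column, and_iff_left rfl]
  have hrow (i : ℕ) (hi : i < b) : (column b).1.rowLen i = 1 := by
    refine eq_of_forall_lt_iff fun j => ?_
    rw [← YoungDiagram.mem_iff_lt_rowLen, mem_column, and_iff_right hi, Nat.lt_one_iff]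
  refine List.eq_replicate_iff.2 ⟨by rw [YoungDiagram.length_rowLens, hcol], fun x hx => ?_⟩
  rw [YoungDiagram.rowLens, List.mem_map, hcol] at hx
  obtain ⟨i, hi, rfl⟩ := hx
  exact hrow i (List.mem_range.1 hi)

theorem inP_column_iff {a : ℕ} (g : Equiv.Perm (Fin (a * b))) :
    InP (column b) a b g ↔ ∀ i, interCard b a b g i = 1 := by
  rw [InP, rowLens_column, Multiset.coe_replicate]
  constructor
  · intro h i
    have hfilter := Multiset.eq_of_le_of_card_le
      (Multiset.filter_le (fun m => m ≠ 0) ((Finset.univ : Finset (Fin b)).val.map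
        (interCard b a b g))) (by rw [h]; simp)
    rw [hfilter] at h
    exact Multiset.eq_of_mem_replicate
      (h ▸ Multiset.mem_map_of_mem (interCard b a b g) (Finset.mem_univ i))
  · intro h
    rw [Multiset.map_congr rfl fun i _ => h i, Multiset.map_const', Multiset.filter_eq_self.2]
    · simp
    · intro x hx
      rw [Multiset.eq_of_mem_replicate hx]
      exact one_ne_zero

end Column

section SplitPoints

variable {k l n : ℕ} (h : k + l = n)

/-- The `n` points as the disjoint union of the first `k` points and the last `l` points, which
turns the embedding of `S_k × S_l` into `S_n` into `Equiv.sumCongr`. -/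
def splitPoints : Fin k ⊕ Fin l ≃ Fin n := finSumFinEquiv.trans (finCongr h)

theorem young_splitPoints (y : Equiv.Perm (Fin k) × Equiv.Perm (Fin l)) (z : Fin k ⊕ Fin l) :
    young h y (splitPoints h z) = splitPoints h (z.map y.1 y.2) := by
  simp [young, splitPoints]

theorem forall_splitPoints {p : Fin n → Prop} :
    (∀ x, p x) ↔ (∀ i, p (splitPoints h (.inl i))) ∧ ∀ x, p (splitPoints h (.inr x)) := by
  rw [← (splitPoints h).forall_congr_right, Sum.forall]

theorem card_filter_splitPoints (p : Fin n → Prop) [DecidablePred p] :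
    (Finset.univ.filter p).card =
      (Finset.univ.filter fun i => p (splitPoints h (.inl i))).card +
        (Finset.univ.filter fun x => p (splitPoints h (.inr x))).card := by
  simp only [Finset.card_filter]
  rw [← (splitPoints h).sum_comp, Fintype.sum_sum_type]

end SplitPoints

section Blocks

variable {a b l : ℕ} (h : b + l = a * b)

theorem block_splitPoints_inl (i : Fin b) : block a b (splitPoints h (.inl i)) = i :=
  Fin.ext (Nat.mod_eq_of_lt i.2)

theorem block_splitPoints_inr {c : ℕ} (h : b + c * b = a * b) (x : Fin (c * b)) :
    block a b (splitPoints h (.inr x)) = block c b x :=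
  Fin.ext (Nat.add_mod_left b x)

theorem block_splitPoints_inr_self (h : b + b = a * b) (i : Fin b) :
    block a b (splitPoints h (.inr i)) = i :=
  Fin.ext ((Nat.add_mod_left b i).trans (Nat.mod_eq_of_lt i.2))

theorem card_block_splitPoints_inl (i : Fin b) :
    (Finset.univ.filter fun z => block a b (splitPoints h (.inl z)) = i).card = 1 :=
  Finset.card_eq_one.2 ⟨i, Finset.ext fun z => by
    rw [Finset.mem_filter, block_splitPoints_inl, Finset.mem_singleton,
      and_iff_right (Finset.mem_univ z)]⟩

theorem interCard_eq {k : ℕ} (h : k + l = a * b) (g : Equiv.Perm (Fin (a * b))) (i : Fin b) :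
    interCard k a b g i =
      (Finset.univ.filter fun z => block a b (g⁻¹ (splitPoints h (.inl z))) = i).card := by
  symm
  refine Finset.card_bij (fun z _ => g⁻¹ (splitPoints h (.inl z))) ?_ ?_ ?_
  · intro z hz
    refine Finset.mem_filter.2 ⟨Finset.mem_univ _, (Finset.mem_filter.1 hz).2, ?_⟩
    rw [show g (g⁻¹ _) = _ from g.apply_symm_apply _]
    exact z.2
  · intro z _ z' _ hz
    exact Sum.inl_injective ((splitPoints h).injective (g⁻¹.injective hz))
  · intro x hx
    obtain ⟨-, hxi, hxk⟩ := Finset.mem_filter.1 hx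
    have hgx : g⁻¹ (splitPoints h (.inl ⟨(g x : ℕ), hxk⟩)) = x :=
      g.symm_apply_eq.2 (Fin.ext rfl)
    exact ⟨⟨(g x : ℕ), hxk⟩, Finset.mem_filter.2 ⟨Finset.mem_univ _, by rw [hgx, hxi]⟩, hgx⟩

theorem exists_perm_of_card_fiber {α β : Type*} [Fintype α] [DecidableEq β] (f f' : α → β)
    (hf : ∀ y, (Finset.univ.filter fun x => f x = y).card =
      (Finset.univ.filter fun x => f' x = y).card) :
    ∃ σ : Equiv.Perm α, ∀ x, f (σ x) = f' x := by
  have e (y : β) : Nonempty ({x // f' x = y} ≃ {x // f x = y}) := by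
    rw [← Fintype.card_eq, Fintype.card_subtype, Fintype.card_subtype, hf]
  exact ⟨Equiv.ofFiberEquiv fun y => (e y).some, Equiv.ofFiberEquiv_map _⟩

theorem inP_column_one (h : b + l = a * b) : InP (column b) a b 1 := by
  refine (inP_column_iff 1).2 fun i => ?_
  rw [interCard_eq h]
  exact card_block_splitPoints_inl h i

theorem exists_young_of_inP_column {g : Equiv.Perm (Fin (a * b))} (hg : InP (column b) a b g) :
    ∃ k, ((young h k)⁻¹ * g, (1 : Equiv.Perm (Fin b))) ∈ wreath a b := by
  have hinl (i : Fin b) :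
      (Finset.univ.filter fun z => block a b (g⁻¹ (splitPoints h (.inl z))) = i).card =
        (Finset.univ.filter fun z => block a b (splitPoints h (.inl z)) = i).card := by
    rw [← interCard_eq, (inP_column_iff g).1 hg, card_block_splitPoints_inl]
  have hinr (i : Fin b) :
      (Finset.univ.filter fun z => block a b (g⁻¹ (splitPoints h (.inr z))) = i).card =
        (Finset.univ.filter fun z => block a b (splitPoints h (.inr z)) = i).card := by
    have hcard : (Finset.univ.filter fun x => block a b (g⁻¹ x) = i).card =
        (Finset.univ.filter fun x => block a b x = i).card :=
      Finset.card_equiv g⁻¹ fun x => by simp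
    rw [card_filter_splitPoints h, card_filter_splitPoints h, hinl] at hcard
    exact Nat.add_left_cancel hcard
  obtain ⟨k₁, hk₁⟩ := exists_perm_of_card_fiber _ _ hinl
  obtain ⟨k₂, hk₂⟩ := exists_perm_of_card_fiber _ _ hinr
  have hinv : (g⁻¹ * young h (k₁, k₂), (1 : Equiv.Perm (Fin b))) ∈ wreath a b := by
    change ∀ x, block a b (g⁻¹ (young h (k₁, k₂) x)) = block a b x
    simp only [forall_splitPoints h, young_splitPoints]
    exact ⟨hk₁, hk₂⟩
  refine ⟨(k₁, k₂), ?_⟩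
  rw [← inv_mem_iff, Prod.inv_mk, mul_inv_rev, inv_inv, inv_one]
  exact hinv

/-- The subgroup of `S_b × S_l` that permutes the parts of `X⁰`. Since the first `b` points lie in
different parts, the permutation of the parts is the component in `S_b`. -/
def blockStabilizer : Subgroup (Equiv.Perm (Fin b) × Equiv.Perm (Fin l)) :=
  (wreath a b).comap ((young h).prod (MonoidHom.fst _ _))

theorem young_mem_wreath_iff (k : Equiv.Perm (Fin b) × Equiv.Perm (Fin l))
    (σ : Equiv.Perm (Fin b)) :
    (young h k, σ) ∈ wreath a b ↔ σ = k.1 ∧ ∀ x, block a b (splitPoints h (.inr (k.2 x))) =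
      σ (block a b (splitPoints h (.inr x))) := by
  change (∀ x, block a b (young h k x) = σ (block a b x)) ↔ _
  simp only [forall_splitPoints h, young_splitPoints, Sum.map_inl, Sum.map_inr,
    block_splitPoints_inl, eq_comm (a := σ), Equiv.ext_iff]

theorem mem_blockStabilizer (k : Equiv.Perm (Fin b) × Equiv.Perm (Fin l)) :
    k ∈ blockStabilizer h ↔ ∀ x, block a b (splitPoints h (.inr (k.2 x))) =
      k.1 (block a b (splitPoints h (.inr x))) :=
  (young_mem_wreath_iff h k k.1).trans (and_iff_right rfl)

theorem blockStabilizer_eq_range_wreath {c : ℕ} (h : b + c * b = a * b) :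
    blockStabilizer h = ((wreathToBlocks c b).prod (wreathToPoints c b)).range := by
  refine Subgroup.ext fun k => ?_
  simp only [mem_blockStabilizer, block_splitPoints_inr]
  constructor
  · exact fun hk => ⟨⟨(k.2, k.1), hk⟩, rfl⟩
  · rintro ⟨w, rfl⟩
    exact w.2

theorem blockStabilizer_eq_range_diagonal (h : b + b = a * b) :
    blockStabilizer h = ((MonoidHom.id _).prod (MonoidHom.id _)).range := by
  refine Subgroup.ext fun k => ?_
  simp only [mem_blockStabilizer, block_splitPoints_inr_self]
  constructor
  · exact fun hk => ⟨k.1, Prod.ext rfl (Equiv.ext hk).symm⟩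
  · rintro ⟨σ, rfl⟩
    exact fun _ => rfl

end Blocks

section Component

variable {a b l : ℕ}

theorem foulkes_mk_of_mem_wreath {ν : Ptn b} {g : Equiv.Perm (Fin (a * b))}
    {σ : Equiv.Perm (Fin b)} (hg : (g, σ) ∈ wreath a b) (v : (spechtSub ν).toSubmodule) :
    foulkes a ν g (Representation.IndV.mk (wreathToPoints a b) (inflation a ν) 1 v) =
      Representation.IndV.mk (wreathToPoints a b) (inflation a ν) 1 (specht ν σ v) :=
  ind_map_mk_one (wreathToPoints a b) (inflation a ν) ⟨(g, σ), hg⟩ v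

/-- The element `e_{t_{X⁰}}` of `F_{(1^b)}^a` for the reference tableau `t`. -/
def columnGenerator (a b : ℕ) :
    Representation.IndV (wreathToPoints a b) (inflation a (column b)) :=
  Representation.IndV.mk (wreathToPoints a b) (inflation a (column b)) 1
    (spechtPolytabloid (refTableau (column b)))

variable (h : b + l = a * b)

theorem component_column : (component a (column b) h (column b)).toSubmodule =
    Submodule.span ℂ (Set.range fun k => foulkesRes a (column b) h k (columnGenerator a b)) := by
  refine le_antisymm (Submodule.span_le.2 ?_) (Submodule.span_le.2 ?_)
  · rintro _ ⟨g, t, hg, rfl⟩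
    obtain ⟨k, hk⟩ := exists_young_of_inP_column h hg
    obtain ⟨σ, rfl⟩ := exists_act_eq (refTableau (column b)) t
    have hsgn : foulkesPolytabloid a g ((refTableau (column b)).act σ) =
        sgn σ • foulkesRes a (column b) h k (columnGenerator a b) := by
      rw [foulkesPolytabloid, ← mul_inv_cancel_left (young h k) g, map_mul, Module.End.mul_apply,
        foulkes_mk_of_mem_wreath hk, map_one, Module.End.one_apply, ← specht_spechtPolytabloid,
        specht_column_spechtPolytabloid, map_smul, map_smul]
      rfl
    rw [hsgn]
    exact Submodule.smul_mem _ _ (Submodule.subset_span ⟨k, rfl⟩)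
  · rintro _ ⟨k, rfl⟩
    refine Submodule.subset_span ⟨young h k, refTableau (column b), ?_, rfl⟩
    rw [← mul_one (young h k), inP_young_mul]
    exact inP_column_one h

theorem foulkesRes_columnGenerator {k : Equiv.Perm (Fin b) × Equiv.Perm (Fin l)}
    (hk : k ∈ blockStabilizer h) :
    foulkesRes a (column b) h k (columnGenerator a b) = sgn k.1 • columnGenerator a b := by
  have hfix : foulkesRes a (column b) h k (columnGenerator a b) =
      Representation.IndV.mk (wreathToPoints a b) (inflation a (column b)) 1
        (specht (column b) k.1 (spechtPolytabloid (refTableau (column b)))) :=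
    foulkes_mk_of_mem_wreath hk _
  rw [hfix, specht_column_spechtPolytabloid, map_smul, columnGenerator]

theorem indCoeff_foulkesRes_columnGenerator [Fintype (wreath a b)]
    (k : Equiv.Perm (Fin b) × Equiv.Perm (Fin l)) :
    indCoeff (wreathToPoints a b) (inflation a (column b))
        (foulkesRes a (column b) h k (columnGenerator a b)) =
      ((Finset.univ.filter fun w : wreath a b => wreathToPoints a b w = young h k).card *
        sgn k.1) • spechtPolytabloid (refTableau (column b)) := by
  have hsum := indCoeff_ind_mk_one (wreathToPoints a b) (inflation a (column b)) (young h k)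
    (spechtPolytabloid (refTableau (column b)))
  refine hsum.trans ?_
  rw [mul_smul, Nat.cast_smul_eq_nsmul]
  refine Finset.sum_eq_card_nsmul fun w hw => ?_
  have hmem : (young h k, wreathToBlocks a b w) ∈ wreath a b :=
    (Finset.mem_filter.1 hw).2 ▸ w.2
  rw [← ((young_mem_wreath_iff h k _).1 hmem).1]
  exact specht_column_spechtPolytabloid _ _

theorem exists_isMonomialGenerator_U : ∃ e, IsMonomialGenerator (blockStabilizer h)
    (sgn.comp (MonoidHom.fst _ _)) (U a (column b) h) e := by
  classical
  let _ : Fintype (wreath a b) := Fintype.ofFinite _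
  have hspan := component_column h
  have hmem : columnGenerator a b ∈ (component a (column b) h (column b)).toSubmodule :=
    hspan ▸ Submodule.subset_span ⟨1, LinearMap.congr_fun (map_one _) _⟩
  let c : (component a (column b) h (column b)).toSubmodule →ₗ[ℂ] ℂ :=
    dot (column b) (MonoidAlgebra.single (Tabloid.mk (refTableau (column b))) 1) ∘ₗ
      (spechtSub (column b)).toSubmodule.subtype ∘ₗ
        indCoeff (wreathToPoints a b) (inflation a (column b)) ∘ₗ Submodule.subtype _
  have hc (k) : c (U a (column b) h k ⟨_, hmem⟩) =
      (Finset.univ.filter fun w : wreath a b => wreathToPoints a b w = young h k).card *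
        sgn k.1 := by
    have hcoeff := congrArg
      (fun v => dot (column b) (MonoidAlgebra.single (Tabloid.mk (refTableau (column b))) 1) v.1)
      (indCoeff_foulkesRes_columnGenerator h k)
    refine hcoeff.trans ?_
    simp only [Submodule.coe_smul, map_smul, spechtPolytabloid, dot_single, coeff_polytabloid_self,
      smul_eq_mul, mul_one]
  refine ⟨⟨_, hmem⟩, ?_, fun k hk => Subtype.ext (foulkesRes_columnGenerator h hk), c, ?_, ?_⟩
  · refine Submodule.map_injective_of_injective (Submodule.injective_subtype _) ?_
    rw [Submodule.map_span, ← Set.range_comp, Submodule.map_subtype_top]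
    exact hspan.symm
  · have hone := hc 1
    rw [map_one, Module.End.one_apply, map_one, Prod.fst_one, map_one, mul_one] at hone
    rw [hone]
    exact Nat.cast_ne_zero.2 (Finset.card_pos.2 ⟨1, by simp⟩).ne'
  · intro k hk
    rw [hc, Finset.filter_eq_empty_iff.2, Finset.card_empty, Nat.cast_zero, zero_mul]
    intro w _ hw
    have hkw : (young h k, wreathToBlocks a b w) ∈ wreath a b := hw ▸ w.2
    refine hk ?_
    rw [((young_mem_wreath_iff h k _).1 hkw).1] at hkw
    exact hkw

end Component

end GenFoulkes

end

theorem corollary2 (b : ℕ) :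
    (∀ (a : ℕ) (ha : 1 ≤ a),
      Nonempty ((U a (column b) (add_pred_mul b ha)).Equiv
        (Representation.directSum fun lam : Ptn b =>
          extTensor (specht lam.conj) (foulkes (a - 1) lam)))) ∧
    Nonempty ((U 2 (column b) (two_mul b).symm).Equiv
      (Representation.directSum fun lam : Ptn b =>
        extTensor (specht lam.conj) (specht lam))) := by
  obtain ⟨q, hq⟩ := exists_isMonomialGenerator_boxSum_conj_specht b
  refine ⟨fun a ha => ?_, ?_⟩
  · obtain ⟨e, he⟩ := exists_isMonomialGenerator_U (add_pred_mul b ha)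
    rw [blockStabilizer_eq_range_wreath] at he
    exact he.nonempty_equiv (hq.toIndBoxSum (wreathToBlocks (a - 1) b) (wreathToPoints (a - 1) b))
  · obtain ⟨e, he⟩ := exists_isMonomialGenerator_U (two_mul b).symm
    rw [blockStabilizer_eq_range_diagonal] at he
    exact he.nonempty_equiv hq
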